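/- Let $\Gamma$ be a rose graph: a single vertex $v$ and a finite set $E$ of loops, the loop $e\in E$ being identified with the segment $[0,\ell_e]$, $\ell_e>0$. Put $L_2(\Gamma)=\bigoplus_{e\in E}L_2(0,\ell_e)$ and $\widetilde{H^2}(\Gamma)=\bigoplus_{e\in E}H^2(0,\ell_e)$ (complex valued functions). For $u\in\widetilde{H^2}(\Gamma)$ let $S(u)=\bigl(u_e(0),u_e'(0),u_e(\ell_e),-u_e'(\ell_e)\bigr)_{e\in E}\in\mathbb C^{4|E|}$ be the vector of the values of $u$ and of its derivatives in the directions into the edges, at the two ends of every edge. Let $G=G(2|E|,4|E|)$ be the Grassmannian of all $2|E|$-dimensional complex subspaces of $\mathbb C^{4|E|}$, with its standard structure of a complex analytic manifold. For $P\in G$ let $H(P)=\{u\in\widetilde{H^2}(\Gamma): S(u)\in P\}$, with the norm of $\widetilde{H^2}(\Gamma)$, and let $L(P)$ be the restriction of the operator $L=-d^2/dx^2$ to $H(P)$. The dispersion relation is $$D_L=\{(P,\lambda)\in G\times\mathbb C:\ \text{the operator } L(P)-\lambda I: H(P)\to L_2(\Gamma)\text{ has no bounded inverse}\}.$$ Then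 $D_L$ is a principal analytic subset of $G\times\mathbb C$: every point of $G\times\mathbb C$ has an open neighbourhood $U$ with a scalar analytic function $f:U\to\mathbb C$ such that $D_L\cap U=\{(P,\lambda)\in U: f(P,\lambda)=0\}$. -/

import Mathlib

open MeasureTheory
open scoped ENNReal ContDiff

/-! ### The Grassmannian as a complex analytic manifold -/

/-- `Gr k V` is the Grassmannian `G(k, n)` of the `k`-dimensional linear subspaces of an
`n`-dimensional complex vector space `V`. -/
def Gr (k : ℕ) (V : Type*) [NormedAddCommGroup V] [NormedSpace ℂ V] : Type _ :=
  {P : Submodule ℂ V // Module.finrank ℂ P = k}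

namespace Gr

/-- An affine chart of the Grassmannian: a `k`-dimensional subspace `base` together with a
complementary subspace `compl`. -/
structure Chart (k : ℕ) (V : Type*) [NormedAddCommGroup V] [NormedSpace ℂ V] where
  /-- the centre of the chart -/
  base : Submodule ℂ V
  /-- the chosen complement of the centre -/
  compl : Submodule ℂ V
  finrank_base : Module.finrank ℂ base = k
  isCompl : IsCompl base compl

variable {k : ℕ} {V : Type*} [NormedAddCommGroup V] [NormedSpace ℂ V]

/-- The coordinate space of a chart: the linear operators from `base` to `compl`. -/
abbrev Chart.Coord (c : Chart k V) : Type _ := c.base →L[ℂ] c.compl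

/-- The graph map `x ↦ x + A x` of an operator `A : base → compl`. -/
noncomputable def Chart.graphMap (c : Chart k V) (A : c.Coord) : c.base →ₗ[ℂ] V :=
  c.base.subtype + c.compl.subtype ∘ₗ (A : c.base →ₗ[ℂ] c.compl)

theorem Chart.graphMap_injective (c : Chart k V) (A : c.Coord) :
    Function.Injective (c.graphMap A) := by
  rw [← LinearMap.ker_eq_bot, LinearMap.ker_eq_bot']
  intro x hx
  have h : (x : V) = -((A x : c.compl) : V) := eq_neg_of_add_eq_zero_left hx
  have hmem : (x : V) ∈ c.compl := by
    rw [h]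
    exact c.compl.neg_mem (A x).2
  exact Subtype.ext (Submodule.disjoint_def.1 c.isCompl.disjoint x x.2 hmem)

/-- The inverse of a chart: it sends the coordinate `A : base → compl` to the graph
`{x + A x | x ∈ base}` of `A`. -/
noncomputable def Chart.param (c : Chart k V) (A : c.Coord) : Gr k V :=
  ⟨LinearMap.range (c.graphMap A),
    (LinearMap.finrank_range_of_inj (c.graphMap_injective A)).trans c.finrank_base⟩

/-- The manifold topology of the Grassmannian: a set is open if and only if it is open in the
coordinates of every affine chart. -/
noncomputable instance instTopologicalSpace : TopologicalSpace (Gr k V) :=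
  ⨆ c : Chart k V, TopologicalSpace.coinduced c.param inferInstance

/-- The parametrization of an open part of `Gr k V × ℂ` by the chart `c` of the first factor. -/
noncomputable def Chart.paramProd (c : Chart k V) (z : c.Coord × ℂ) : Gr k V × ℂ := (c.param z.1, z.2)

/-- The scalar function `f` is (complex) analytic on the subset `U` of the complex manifold
`Gr k V × ℂ`: it is analytic on `U` in the coordinates of every affine chart. -/
def IsAnalyticOn (f : Gr k V × ℂ → ℂ) (U : Set (Gr k V × ℂ)) : Prop :=
  ∀ c : Chart k V, AnalyticOnNhd ℂ (f ∘ c.paramProd) (c.paramProd ⁻¹' U)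

/-- A subset `D` of `Gr k V × ℂ` is a principal analytic subset if every point of `Gr k V × ℂ`
(in `D` or not) has an open neighbourhood in which `D` is the zero set of a single scalar
analytic function. -/
def IsPrincipalAnalyticSubset (D : Set (Gr k V × ℂ)) : Prop :=
  ∀ p : Gr k V × ℂ, ∃ U : Set (Gr k V × ℂ), IsOpen U ∧ p ∈ U ∧
    ∃ f : Gr k V × ℂ → ℂ, IsAnalyticOn f U ∧ ∀ q ∈ U, q ∈ D ↔ f q = 0

end Gr

noncomputable section

/-! ### The Sobolev space `H²` of an interval -/

/-- The Hilbert space `L²(0, ℓ)` of complex valued functions. -/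
abbrev L2 (ℓ : ℝ) : Type := Lp ℂ 2 (volume.restrict (Set.Ioo 0 ℓ))

/-- Test functions on the open interval `(0, ℓ)`: smooth with compact support in `(0, ℓ)`. -/
structure IsTestFun (ℓ : ℝ) (φ : ℝ → ℂ) : Prop where
  contDiff : ContDiff ℝ ∞ φ
  hasCompactSupport : HasCompactSupport φ
  tsupport_subset : tsupport φ ⊆ Set.Ioo 0 ℓ

/-- `v` is the weak derivative of `u` on the open interval `(0, ℓ)`. -/
def IsWeakDeriv (ℓ : ℝ) (u v : L2 ℓ) : Prop :=
  ∀ φ : ℝ → ℂ, IsTestFun ℓ φ →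
    ∫ x in Set.Ioo 0 ℓ, u x * deriv φ x = -∫ x in Set.Ioo 0 ℓ, v x * φ x

theorem L2.integrable_mul {ℓ : ℝ} (u : L2 ℓ) {φ : ℝ → ℂ} (hc : Continuous φ)
    (hs : HasCompactSupport φ) :
    Integrable (fun x => u x * φ x) (volume.restrict (Set.Ioo 0 ℓ)) :=
  MemLp.integrable_mul (q := 2) (Lp.memLp u) (hc.memLp_of_hasCompactSupport hs)

theorem L2.integral_add_mul {ℓ : ℝ} (u v : L2 ℓ) {φ : ℝ → ℂ} (hc : Continuous φ)
    (hs : HasCompactSupport φ) :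
    ∫ x in Set.Ioo 0 ℓ, (u + v) x * φ x =
      (∫ x in Set.Ioo 0 ℓ, u x * φ x) + ∫ x in Set.Ioo 0 ℓ, v x * φ x := by
  rw [← integral_add (L2.integrable_mul u hc hs) (L2.integrable_mul v hc hs)]
  refine integral_congr_ae ?_
  filter_upwards [Lp.coeFn_add u v] with x hx
  rw [hx, Pi.add_apply, add_mul]

theorem L2.integral_smul_mul {ℓ : ℝ} (a : ℂ) (u : L2 ℓ) (φ : ℝ → ℂ) :
    ∫ x in Set.Ioo 0 ℓ, (a • u) x * φ x = a * ∫ x in Set.Ioo 0 ℓ, u x * φ x := by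
  rw [← integral_const_mul]
  refine integral_congr_ae ?_
  filter_upwards [Lp.coeFn_smul a u] with x hx
  rw [hx, Pi.smul_apply, smul_eq_mul, mul_assoc]

theorem IsWeakDeriv.zero (ℓ : ℝ) : IsWeakDeriv ℓ 0 0 := by
  intro φ _
  have h : ∀ ψ : ℝ → ℂ, ∫ x in Set.Ioo 0 ℓ, (0 : L2 ℓ) x * ψ x = 0 := fun ψ => by
    simpa using L2.integral_smul_mul 0 (0 : L2 ℓ) ψ
  rw [h, h, neg_zero]

theorem IsWeakDeriv.add {ℓ : ℝ} {u v u' v' : L2 ℓ} (h : IsWeakDeriv ℓ u v)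
    (h' : IsWeakDeriv ℓ u' v') : IsWeakDeriv ℓ (u + u') (v + v') := by
  intro φ hφ
  rw [L2.integral_add_mul _ _ (hφ.contDiff.continuous_deriv (by simp)) hφ.hasCompactSupport.deriv,
    L2.integral_add_mul _ _ hφ.contDiff.continuous hφ.hasCompactSupport, h φ hφ, h' φ hφ, neg_add]

theorem IsWeakDeriv.smul {ℓ : ℝ} (a : ℂ) {u v : L2 ℓ} (h : IsWeakDeriv ℓ u v) :
    IsWeakDeriv ℓ (a • u) (a • v) := by
  intro φ hφ
  rw [L2.integral_smul_mul, L2.integral_smul_mul, h φ hφ, mul_neg]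

/-- The Sobolev space `H²(0, ℓ)`. A function `u` in it is recorded as the triple `(u, u', u'')` of
`L²` functions, where `u'` is the weak derivative of `u` and `u''` that of `u'`. Weak derivatives
are unique, so such a triple is the same as its first entry `u`. The norm is the Sobolev norm
`‖u‖² = ‖u‖²_{L²} + ‖u'‖²_{L²} + ‖u''‖²_{L²}`. -/
def H2 (ℓ : ℝ) : Submodule ℂ (PiLp 2 (fun _ : Fin 3 => L2 ℓ)) where
  carrier := {u | IsWeakDeriv ℓ (u 0) (u 1) ∧ IsWeakDeriv ℓ (u 1) (u 2)}
  zero_mem' := ⟨IsWeakDeriv.zero ℓ, IsWeakDeriv.zero ℓ⟩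
  add_mem' h h' := ⟨h.1.add h'.1, h.2.add h'.2⟩
  smul_mem' a _ h := ⟨h.1.smul a, h.2.smul a⟩

/-- The inclusion or a (weak) derivative, as a bounded operator `H²(0, ℓ) → L²(0, ℓ)`: it sends
`u` to `u`, `u'`, `u''` for `i = 0, 1, 2`. -/
def H2.derivL (ℓ : ℝ) (i : Fin 3) : H2 ℓ →L[ℂ] L2 ℓ :=
  (PiLp.proj 2 (fun _ : Fin 3 => L2 ℓ) i : PiLp 2 (fun _ : Fin 3 => L2 ℓ) →L[ℂ] L2 ℓ) ∘L
    (H2 ℓ).subtypeL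

/-! ### The rose graph -/

/-- The space of vertex values: values and derivatives at both ends of all the edges. Its
dimension is `4 |E|`. -/
abbrev VertexSpace (E : Type*) : Type _ := E × Fin 4 → ℂ

variable {E : Type*} [Fintype E] (len : E → ℝ)

/-- `L²(Γ)`, the orthogonal sum over the edges `e` of the spaces `L²(0, len e)`. -/
abbrev GraphL2 : Type _ := PiLp 2 (fun e : E => L2 (len e))

/-- The orthogonal sum over the edges `e` of the spaces `H²(0, len e)`. -/
abbrev GraphH2 : Type _ := PiLp 2 (fun e : E => H2 (len e))

/-- Applies to the function on each edge the operator `T e`. -/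
def edgewise (T : ∀ e, H2 (len e) →L[ℂ] L2 (len e)) : GraphH2 len →L[ℂ] GraphL2 len :=
  ((PiLp.continuousLinearEquiv 2 ℂ (fun e : E => L2 (len e))).symm :
      (∀ e, L2 (len e)) →L[ℂ] GraphL2 len) ∘L
    ContinuousLinearMap.pi fun e => T e ∘L PiLp.proj 2 (fun e : E => H2 (len e)) e

/-- The operator `u ↦ -u''` on the edges, before vertex conditions are imposed. -/
def laplacian : GraphH2 len →L[ℂ] GraphL2 len :=
  edgewise len fun e => -H2.derivL (len e) 2

/-- The inclusion of `⨁ H²(e)` in `L²(Γ)`. -/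
def inclusion : GraphH2 len →L[ℂ] GraphL2 len :=
  edgewise len fun e => H2.derivL (len e) 0

/-- On each edge `e`, `g e` is a continuous representative of `u` and `g' e` one of `u'`, up to the
ends of the edge. For edges of positive length these exist and, on `[0, len e]`, are unique. -/
structure IsContRep {len : E → ℝ} (u : GraphH2 len) (g g' : E → ℝ → ℂ) : Prop where
  cont : ∀ e, ContinuousOn (g e) (Set.Icc 0 (len e))
  cont' : ∀ e, ContinuousOn (g' e) (Set.Icc 0 (len e))
  ae_eq : ∀ e, H2.derivL (len e) 0 (u e) =ᵐ[volume.restrict (Set.Ioo 0 (len e))] g e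
  ae_eq' : ∀ e, H2.derivL (len e) 1 (u e) =ᵐ[volume.restrict (Set.Ioo 0 (len e))] g' e

/-- The vertex values `(g(0), g'(0), g(ℓ), -g'(ℓ))` on each edge: the values of the function at the
two ends of the edge, and the derivatives there in the directions into the edge. -/
def vertexValues (g g' : E → ℝ → ℂ) : VertexSpace E := fun p =>
  ![g p.1 0, g' p.1 0, g p.1 (len p.1), -g' p.1 (len p.1)] p.2

/-- `H(P)`: the functions of `⨁ H²(e)` with vertex values in `P`. -/
def domainH (P : Submodule ℂ (VertexSpace E)) : Submodule ℂ (GraphH2 len) where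
  carrier := {u | ∃ g g' : E → ℝ → ℂ, IsContRep u g g' ∧ vertexValues len g g' ∈ P}
  zero_mem' := by
    refine ⟨0, 0, ⟨fun _ => continuousOn_const, fun _ => continuousOn_const,
      fun e => ?_, fun e => ?_⟩, ?_⟩
    · exact Lp.coeFn_zero ℂ 2 (volume.restrict (Set.Ioo 0 (len e)))
    · exact Lp.coeFn_zero ℂ 2 (volume.restrict (Set.Ioo 0 (len e)))
    · convert P.zero_mem
      ext ⟨e, i⟩
      fin_cases i <;> simp [vertexValues]
  add_mem' := by
    rintro u v ⟨g, g', hg, hP⟩ ⟨k, k', hk, hQ⟩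
    refine ⟨g + k, g' + k', ⟨fun e => (hg.cont e).add (hk.cont e),
      fun e => (hg.cont' e).add (hk.cont' e), fun e => ?_, fun e => ?_⟩, ?_⟩
    · exact (Lp.coeFn_add _ _).trans ((hg.ae_eq e).add (hk.ae_eq e))
    · exact (Lp.coeFn_add _ _).trans ((hg.ae_eq' e).add (hk.ae_eq' e))
    · convert P.add_mem hP hQ
      ext ⟨e, i⟩
      fin_cases i <;> simp [vertexValues, add_comm]
  smul_mem' := by
    rintro a u ⟨g, g', hg, hP⟩
    refine ⟨a • g, a • g', ⟨fun e => (hg.cont e).const_smul a,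
      fun e => (hg.cont' e).const_smul a, fun e => ?_, fun e => ?_⟩, ?_⟩
    · exact (Lp.coeFn_smul _ _).trans ((hg.ae_eq e).const_smul a)
    · exact (Lp.coeFn_smul _ _).trans ((hg.ae_eq' e).const_smul a)
    · convert P.smul_mem a hP
      ext ⟨e, i⟩
      fin_cases i <;> simp [vertexValues]

/-- The operator `L(P) - λ : H(P) → L²(Γ)`, where `L(P)` is the restriction of `-d²/dx²` to
`H(P)`. -/
def shiftedOp (P : Submodule ℂ (VertexSpace E)) (lam : ℂ) : domainH len P →L[ℂ] GraphL2 len :=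
  (laplacian len - lam • inclusion len) ∘L (domainH len P).subtypeL

/-- The dispersion relation: the pairs `(P, λ)` for which `L(P) - λ` has no bounded inverse
`L²(Γ) → H(P)`. -/
def dispersionRelation : Set (Gr (2 * Fintype.card E) (VertexSpace E) × ℂ) :=
  {q | ¬ (shiftedOp len q.1.1 q.2).IsInvertible}

end

/-! On every edge the equation `-u'' = λu` has a two-dimensional solution space, parametrized by the
Cauchy data at `0`. The vertex values of all solutions therefore form a subspace `N(λ)` of dimension
`2|E|`, the range of `cauchyMap`; its spanning vectors are entire in `λ`, because their entries come
from the exponential of a matrix affine in `λ`.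

`L(P) - λ` is invertible if and only if `P ∩ N(λ) = 0` (`shiftedOp_isInvertible_iff`). A common
vector is the trace of a solution lying in `H(P)`, that is, of a kernel element. Conversely, if the
intersection is zero, then `P ⊕ N(λ)` is the whole space by dimension; any solution of `-u'' - λu =
f` is moved into `H(P)` by subtracting a homogeneous solution, and the inverse is bounded by the
open mapping theorem.

Transversality of two half-dimensional subspaces is the nonvanishing of the determinant of a joint
basis. This determinant depends on the basis of `P` through a scalar factor, so it is divided by the
determinant of the same basis with a fixed basis of a complement `Q` of the given point `P₀`. The
quotient is a function on the Grassmannian, analytic wherever `P` is transverse to `Q`, and it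
vanishes exactly on the dispersion relation. -/

noncomputable section

/-! ### Weak derivatives on an interval -/

/-- `v` is the weak derivative of the function `u` on `(0, ℓ)`. -/
def HasWeakDeriv (ℓ : ℝ) (u v : ℝ → ℂ) : Prop :=
  ∀ φ : ℝ → ℂ, IsTestFun ℓ φ →
    ∫ x in Set.Ioo 0 ℓ, u x * deriv φ x = -∫ x in Set.Ioo 0 ℓ, v x * φ x

theorem integrableOn_mul_continuous {ℓ : ℝ} {u φ : ℝ → ℂ} (hu : IntegrableOn u (Set.Ioo 0 ℓ))
    (hφ : Continuous φ) : IntegrableOn (fun x => u x * φ x) (Set.Ioo 0 ℓ) :=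
  hu.mul_continuousOn_of_subset hφ.continuousOn measurableSet_Ioo isCompact_Icc
    Set.Ioo_subset_Icc_self

namespace HasWeakDeriv

variable {ℓ : ℝ} {u v u' v' : ℝ → ℂ}

theorem congr (h : HasWeakDeriv ℓ u v) (hu : u =ᵐ[volume.restrict (Set.Ioo 0 ℓ)] u')
    (hv : v =ᵐ[volume.restrict (Set.Ioo 0 ℓ)] v') : HasWeakDeriv ℓ u' v' := by
  intro φ hφ
  have h1 : ∫ x in Set.Ioo 0 ℓ, u' x * deriv φ x = ∫ x in Set.Ioo 0 ℓ, u x * deriv φ x :=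
    integral_congr_ae (by filter_upwards [hu] with x hx; rw [hx])
  have h2 : ∫ x in Set.Ioo 0 ℓ, v' x * φ x = ∫ x in Set.Ioo 0 ℓ, v x * φ x :=
    integral_congr_ae (by filter_upwards [hv] with x hx; rw [hx])
  rw [h1, h2, h φ hφ]

theorem add (h : HasWeakDeriv ℓ u v) (h' : HasWeakDeriv ℓ u' v')
    (hu : IntegrableOn u (Set.Ioo 0 ℓ)) (hv : IntegrableOn v (Set.Ioo 0 ℓ))
    (hu' : IntegrableOn u' (Set.Ioo 0 ℓ)) (hv' : IntegrableOn v' (Set.Ioo 0 ℓ)) :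
    HasWeakDeriv ℓ (u + u') (v + v') := by
  intro φ hφ
  have hc := hφ.contDiff.continuous
  have hd := hφ.contDiff.continuous_deriv (by simp)
  simp only [Pi.add_apply, add_mul]
  rw [integral_add (integrableOn_mul_continuous hu hd) (integrableOn_mul_continuous hu' hd),
    integral_add (integrableOn_mul_continuous hv hc) (integrableOn_mul_continuous hv' hc),
    h φ hφ, h' φ hφ, neg_add]

theorem const_mul (h : HasWeakDeriv ℓ u v) (a : ℂ) :
    HasWeakDeriv ℓ (fun x => a * u x) (fun x => a * v x) := by
  intro φ hφ
  simp only [mul_assoc]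
  rw [integral_const_mul, integral_const_mul, h φ hφ, mul_neg]

/-- The Leibniz rule for the product of a weakly differentiable and a smooth function. -/
theorem mul_smooth (h : HasWeakDeriv ℓ u v) (hu : IntegrableOn u (Set.Ioo 0 ℓ))
    (hv : IntegrableOn v (Set.Ioo 0 ℓ)) {g g' : ℝ → ℂ} (hg : ContDiff ℝ ∞ g)
    (hg' : ∀ x, HasDerivAt g (g' x) x) :
    HasWeakDeriv ℓ (fun x => u x * g x) (fun x => v x * g x + u x * g' x) := by
  intro φ hφ
  have hc := hφ.contDiff.continuous
  have hd := hφ.contDiff.continuous_deriv (by simp)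
  have hgd : deriv g = g' := funext fun x => (hg' x).deriv
  have hg'c : Continuous g' := hgd ▸ hg.continuous_deriv (by simp)
  -- `gφ` is again a test function; the rule is the definition for `u` tested against it.
  have htest : IsTestFun ℓ (fun x => g x * φ x) :=
    ⟨hg.mul hφ.contDiff, hφ.hasCompactSupport.mul_left,
      (tsupport_mul_subset_right (f := g) (g := φ)).trans hφ.tsupport_subset⟩
  have hder : ∀ x, deriv (fun x => g x * φ x) x = g' x * φ x + g x * deriv φ x := fun x =>
    ((hg' x).mul ((hφ.contDiff.differentiable (by simp)) x).hasDerivAt).deriv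
  have key := h _ htest
  simp only [hder] at key
  have i1 : IntegrableOn (fun x => u x * (g' x * φ x)) (Set.Ioo 0 ℓ) :=
    integrableOn_mul_continuous hu (hg'c.mul hc)
  have i2 : IntegrableOn (fun x => u x * (g x * deriv φ x)) (Set.Ioo 0 ℓ) :=
    integrableOn_mul_continuous hu (hg.continuous.mul hd)
  have i3 : IntegrableOn (fun x => v x * (g x * φ x)) (Set.Ioo 0 ℓ) :=
    integrableOn_mul_continuous hv (hg.continuous.mul hc)
  have e1 : ∫ x in Set.Ioo 0 ℓ, u x * (g' x * φ x + g x * deriv φ x) =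
      (∫ x in Set.Ioo 0 ℓ, u x * (g' x * φ x)) + ∫ x in Set.Ioo 0 ℓ, u x * (g x * deriv φ x) := by
    rw [← integral_add i1 i2]
    simp only [mul_add]
  have e2 : ∫ x in Set.Ioo 0 ℓ, (v x * g x + u x * g' x) * φ x =
      (∫ x in Set.Ioo 0 ℓ, v x * (g x * φ x)) + ∫ x in Set.Ioo 0 ℓ, u x * (g' x * φ x) := by
    rw [← integral_add i3 i1]
    simp only [add_mul, mul_assoc]
  simp only [mul_assoc] at e1 e2 ⊢
  rw [e2]
  linear_combination key - e1

end HasWeakDeriv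

/-- Integration by parts for the primitive of an integrable function. -/
theorem integral_primitive_mul {ℓ : ℝ} {h φ ψ : ℝ → ℂ}
    (hh : IntegrableOn h (Set.Ioo 0 ℓ)) (hφ : ∀ x, HasDerivAt φ (ψ x) x) (hψ : Continuous ψ) :
    ∫ x in Set.Ioo 0 ℓ, (∫ t in (0 : ℝ)..x, h t) * ψ x =
      (∫ t in Set.Ioo 0 ℓ, h t) * φ ℓ - ∫ x in Set.Ioo 0 ℓ, h x * φ x := by
  have hφc : Continuous φ := continuous_iff_continuousAt.2 fun x => (hφ x).continuousAt
  have hψi : IntegrableOn ψ (Set.Ioo 0 ℓ) :=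
    (hψ.integrableOn_Icc).mono_set Set.Ioo_subset_Icc_self
  -- Fubini for `ψ(x) h(t)` on the triangle `t < x`. Since `φ` need not vanish at `ℓ`, a boundary
  -- term survives.
  let F : ℝ × ℝ → ℂ := Set.indicator {p : ℝ × ℝ | p.2 < p.1} fun p => ψ p.1 * h p.2
  have hF : Integrable F ((volume.restrict (Set.Ioo 0 ℓ)).prod (volume.restrict (Set.Ioo 0 ℓ))) :=
    (Integrable.mul_prod hψi hh).indicator (measurableSet_lt measurable_snd measurable_fst)
  have h1 : ∀ x ∈ Set.Ioo 0 ℓ, ∫ t in Set.Ioo 0 ℓ, F (x, t) = (∫ t in (0 : ℝ)..x, h t) * ψ x := by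
    intro x hx
    have : ∀ t, F (x, t) = Set.indicator (Set.Iio x) (fun t => ψ x * h t) t := fun t => by
      simp [F, Set.indicator]
    simp only [this]
    rw [integral_indicator measurableSet_Iio, Measure.restrict_restrict measurableSet_Iio,
      integral_const_mul, mul_comm, intervalIntegral.integral_of_le hx.1.le,
      integral_Ioc_eq_integral_Ioo, Set.inter_comm, Set.Ioo_inter_Iio, min_eq_right hx.2.le]
  have h2 : ∀ t ∈ Set.Ioo 0 ℓ, ∫ x in Set.Ioo 0 ℓ, F (x, t) = h t * (φ ℓ - φ t) := by
    intro t ht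
    have : ∀ x, F (x, t) = Set.indicator (Set.Ioi t) (fun x => ψ x * h t) x := fun x => by
      simp [F, Set.indicator]
    simp only [this]
    rw [integral_indicator measurableSet_Ioi, Measure.restrict_restrict measurableSet_Ioi,
      integral_mul_const, mul_comm, ← intervalIntegral.integral_eq_sub_of_hasDerivAt
        (fun x _ => hφ x) (hψ.intervalIntegrable _ _), intervalIntegral.integral_of_le ht.2.le,
      integral_Ioc_eq_integral_Ioo, Set.inter_comm, Set.Ioo_inter_Ioi, max_eq_right ht.1.le]
  calc _ = ∫ x in Set.Ioo 0 ℓ, ∫ t in Set.Ioo 0 ℓ, F (x, t) :=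
        (setIntegral_congr_fun measurableSet_Ioo h1).symm
    _ = ∫ t in Set.Ioo 0 ℓ, ∫ x in Set.Ioo 0 ℓ, F (x, t) :=
        integral_integral_swap (f := fun x t => F (x, t)) hF
    _ = ∫ t in Set.Ioo 0 ℓ, (h t * φ ℓ - h t * φ t) := by
        rw [setIntegral_congr_fun measurableSet_Ioo h2]
        simp only [mul_sub]
    _ = _ := by
        rw [integral_sub (Integrable.mul_const hh _) (integrableOn_mul_continuous hh hφc),
          integral_mul_const]

theorem continuousOn_primitive_Icc {ℓ : ℝ} {h : ℝ → ℂ}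
    (hh : IntegrableOn h (Set.Ioo 0 ℓ)) :
    ContinuousOn (fun x => ∫ t in (0 : ℝ)..x, h t) (Set.Icc 0 ℓ) := by
  rcases lt_or_ge ℓ 0 with hl | hl
  · rw [Set.Icc_eq_empty (not_le.2 hl)]; exact continuousOn_empty _
  · have := intervalIntegral.continuousOn_primitive_interval (f := h) (a := 0) (b := ℓ)
      (μ := volume) (by rw [Set.uIcc_of_le hl, integrableOn_Icc_iff_integrableOn_Ioo]; exact hh)
    rwa [Set.uIcc_of_le hl] at this

theorem ContinuousOn.integrableOn_Ioo {ℓ : ℝ} {g : ℝ → ℂ} (hg : ContinuousOn g (Set.Icc 0 ℓ)) :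
    IntegrableOn g (Set.Ioo 0 ℓ) :=
  (hg.integrableOn_Icc).mono_set Set.Ioo_subset_Icc_self

theorem IsTestFun.apply_right {ℓ : ℝ} {φ : ℝ → ℂ} (hφ : IsTestFun ℓ φ) : φ ℓ = 0 :=
  image_eq_zero_of_notMem_tsupport fun h => lt_irrefl _ (hφ.tsupport_subset h).2

theorem hasWeakDeriv_primitive {ℓ : ℝ} {h : ℝ → ℂ}
    (hh : IntegrableOn h (Set.Ioo 0 ℓ)) :
    HasWeakDeriv ℓ (fun x => ∫ t in (0 : ℝ)..x, h t) h := by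
  intro φ hφ
  rw [integral_primitive_mul hh
    (fun x => ((hφ.contDiff.differentiable (by simp)) x).hasDerivAt)
    (hφ.contDiff.continuous_deriv (by simp)), hφ.apply_right]
  simp

theorem hasWeakDeriv_const {ℓ : ℝ} (hℓ : 0 < ℓ) (c : ℂ) : HasWeakDeriv ℓ (fun _ => c) 0 := by
  intro φ hφ
  have h0 : φ 0 = 0 :=
    image_eq_zero_of_notMem_tsupport fun h => lt_irrefl _ (hφ.tsupport_subset h).1
  rw [integral_const_mul, ← integral_Ioc_eq_integral_Ioo,
    ← intervalIntegral.integral_of_le hℓ.le, intervalIntegral.integral_deriv_eq_sub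
      (fun x _ => (hφ.contDiff.differentiable (by simp)) x)
      ((hφ.contDiff.continuous_deriv (by simp)).intervalIntegrable _ _), hφ.apply_right, h0]
  simp

/-- A smooth function of integral zero, with compact support in `(0, ℓ)`, is the derivative of
such a function. -/
theorem exists_isTestFun_deriv_eq {ℓ : ℝ} {h : ℝ → ℝ} (hs : ContDiff ℝ ∞ h) {a b : ℝ}
    (ha : 0 < a) (hb : b < ℓ) (hab : a ≤ b) (hsupp : Function.support h ⊆ Set.Icc a b)
    (hint : ∫ x, h x = 0) :
    ∃ φ : ℝ → ℂ, IsTestFun ℓ φ ∧ ∀ x, deriv φ x = h x := by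
  let k : ℝ → ℂ := fun x => (h x : ℂ)
  have hk : ContDiff ℝ ∞ k := Complex.ofRealCLM.contDiff.comp hs
  have hk0 : ∀ x, x ∉ Set.Icc a b → k x = 0 := fun x hx => by
    have : h x = 0 := by
      by_contra h0
      exact hx (hsupp h0)
    simp [k, this]
  let φ : ℝ → ℂ := fun x => ∫ t in (0 : ℝ)..x, k t
  have hder : ∀ x, HasDerivAt φ (k x) x := fun x =>
    (hk.continuous.integral_hasStrictDerivAt 0 x).hasDerivAt
  have hφ : ContDiff ℝ ∞ φ := by
    rw [contDiff_infty_iff_deriv]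
    refine ⟨fun x => (hder x).differentiableAt, ?_⟩
    rwa [show deriv φ = k from funext fun x => (hder x).deriv]
  have hsub : Function.support φ ⊆ Set.Icc a b := by
    intro x hx
    by_contra hxab
    apply hx
    rcases lt_or_ge x a with hxa | hxa
    · refine intervalIntegral.integral_zero_ae (Filter.Eventually.of_forall fun t ht => hk0 t ?_)
      intro h1
      have : t ≤ max 0 x := ht.2
      have := max_lt ha hxa
      linarith [h1.1]
    -- To the right of `b` the primitive equals the full integral of `h`, which is zero.
    · have hbx : b < x := by
        by_contra h1
        exact hxab ⟨hxa, not_lt.1 h1⟩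
      show ∫ t in (0 : ℝ)..x, k t = 0
      rw [intervalIntegral.integral_of_le (by linarith),
        setIntegral_eq_integral_of_forall_compl_eq_zero]
      · simp only [k]
        rw [integral_complex_ofReal, hint, Complex.ofReal_zero]
      · intro t ht
        exact hk0 t fun h1 => ht ⟨by linarith [h1.1], by linarith [h1.2]⟩
  have hts : tsupport φ ⊆ Set.Icc a b := closure_minimal hsub isClosed_Icc
  exact ⟨φ, ⟨hφ, isCompact_Icc.of_isClosed_subset (isClosed_tsupport _) hts,
    hts.trans fun x hx => ⟨ha.trans_le hx.1, hx.2.trans_lt hb⟩⟩, fun x => (hder x).deriv⟩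

/-- The lemma of du Bois-Reymond. -/
theorem HasWeakDeriv.ae_eq_const {ℓ : ℝ} (hℓ : 0 < ℓ) {u : ℝ → ℂ} (h : HasWeakDeriv ℓ u 0)
    (hu : IntegrableOn u (Set.Ioo 0 ℓ)) :
    ∃ c : ℂ, u =ᵐ[volume.restrict (Set.Ioo 0 ℓ)] fun _ => c := by
  -- A bump `ρ` of mass one with support well inside `(0, ℓ)`; the constant will be `c = ∫ uρ`.
  let β : ContDiffBump (ℓ / 2) := ⟨ℓ / 8, ℓ / 4, by positivity, by linarith⟩
  let ρ : ℝ → ℝ := β.normed volume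
  have hρ : ContDiff ℝ ∞ ρ := β.contDiff_normed
  have hρi : ∫ x, ρ x = 1 := β.integral_normed
  have hρint : Integrable ρ := β.integrable_normed
  have hρs : tsupport ρ = Set.Icc (ℓ / 4) (3 * ℓ / 4) := by
    rw [β.tsupport_normed_eq, Real.closedBall_eq_Icc]
    congr 1 <;> simp only [β] <;> ring
  have hρ0 : Function.support ρ ⊆ Set.Ioo 0 ℓ := (subset_tsupport ρ).trans
    (hρs ▸ fun x hx => ⟨by linarith [hx.1], by linarith [hx.2]⟩)
  let c : ℂ := ∫ x in Set.Ioo 0 ℓ, u x * ρ x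
  refine ⟨c, ?_⟩
  have hloc : LocallyIntegrableOn (fun x => u x - c) (Set.Ioo 0 ℓ) :=
    (hu.sub (integrableOn_const (by simp))).locallyIntegrableOn
  have hz := isOpen_Ioo.ae_eq_zero_of_integral_contDiff_smul_eq_zero hloc ?_
  · rw [Filter.EventuallyEq, ae_restrict_iff' measurableSet_Ioo]
    filter_upwards [hz] with x hx hx'
    exact sub_eq_zero.1 (hx hx')
  · intro g hg hgc hgs
    let K : Set ℝ := tsupport g ∪ tsupport ρ
    have hK : IsCompact K := hgc.isCompact.union (hρs ▸ isCompact_Icc)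
    have hKsub : K ⊆ Set.Ioo 0 ℓ := Set.union_subset hgs
      (hρs ▸ fun x hx => ⟨by linarith [hx.1], by linarith [hx.2]⟩)
    have hKne : K.Nonempty := ⟨ℓ / 2, Or.inr (hρs ▸ ⟨by linarith, by linarith⟩)⟩
    obtain ⟨a, haK, ha⟩ := hK.exists_isLeast hKne
    obtain ⟨b, hbK, hb⟩ := hK.exists_isGreatest hKne
    have hgint : Integrable g := hg.continuous.integrable_of_hasCompactSupport hgc
    set m : ℝ := ∫ x, g x with hm
    -- `g - mρ` has mean zero, so it is the derivative of a test function. Testing with that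
    -- function gives `∫ u(g - mρ) = 0`, which is `∫ g(u - c) = 0`.
    obtain ⟨φ, hφ, hφd⟩ := exists_isTestFun_deriv_eq (h := fun x => g x - m * ρ x) (ℓ := ℓ)
      (hg.sub (contDiff_const.mul hρ)) (hKsub haK).1 (hKsub hbK).2 (ha hbK) (by
        intro x hx
        have hxK : x ∈ K := by
          by_contra hxK
          apply hx
          simp only [K, Set.mem_union, not_or] at hxK
          show g x - m * ρ x = 0
          rw [image_eq_zero_of_notMem_tsupport hxK.1, image_eq_zero_of_notMem_tsupport hxK.2]
          ring
        exact ⟨ha hxK, hb hxK⟩) (by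
        rw [integral_sub hgint (hρint.const_mul m), integral_const_mul, hρi]; ring)
    have key := h φ hφ
    simp only [hφd, Pi.zero_apply, zero_mul, integral_zero, neg_zero] at key
    have hgs0 : Function.support g ⊆ Set.Ioo 0 ℓ := (subset_tsupport g).trans hgs
    have hgC : Continuous fun x => (g x : ℂ) := Complex.continuous_ofReal.comp hg.continuous
    have hρC : Continuous fun x => (ρ x : ℂ) := Complex.continuous_ofReal.comp hρ.continuous
    have i1 := integrableOn_mul_continuous hu hgC
    have i2 := integrableOn_mul_continuous hu hρC
    have e1 : ∫ x in Set.Ioo 0 ℓ, u x * ((g x - m * ρ x : ℝ) : ℂ) =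
        (∫ x in Set.Ioo 0 ℓ, u x * g x) - m * c := by
      rw [← integral_const_mul, ← integral_sub i1 (i2.const_mul _)]
      congr 1; ext x; push_cast; ring
    have e2 : ∫ x in Set.Ioo 0 ℓ, (g x : ℂ) = m := by
      rw [setIntegral_eq_integral_of_forall_compl_eq_zero, integral_complex_ofReal]
      intro x hx
      have : g x = 0 := by
        by_contra h0
        exact hx (hgs0 h0)
      simp [this]
    have e3 : ∫ x, g x • (u x - c) = ∫ x in Set.Ioo 0 ℓ, g x • (u x - c) := by
      rw [setIntegral_eq_integral_of_forall_compl_eq_zero]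
      intro x hx
      have : g x = 0 := by
        by_contra h0
        exact hx (hgs0 h0)
      simp [this]
    rw [e3]
    have e4 : ∫ x in Set.Ioo 0 ℓ, g x • (u x - c) =
        (∫ x in Set.Ioo 0 ℓ, u x * g x) - ∫ x in Set.Ioo 0 ℓ, c * (g x : ℂ) := by
      rw [← integral_sub i1 ((hgC.integrableOn_Icc.mono_set Set.Ioo_subset_Icc_self).const_mul c)]
      congr 1; ext x; rw [Complex.real_smul]; ring
    rw [e4, integral_const_mul, e2]
    rw [e1] at key
    linear_combination key

/-- A weakly differentiable function is, up to a constant, the primitive of its derivative. -/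
theorem HasWeakDeriv.exists_ae_eq {ℓ : ℝ} (hℓ : 0 < ℓ) {u v : ℝ → ℂ} (h : HasWeakDeriv ℓ u v)
    (hu : IntegrableOn u (Set.Ioo 0 ℓ)) (hv : IntegrableOn v (Set.Ioo 0 ℓ)) :
    ∃ c : ℂ, u =ᵐ[volume.restrict (Set.Ioo 0 ℓ)] fun x => c + ∫ t in (0 : ℝ)..x, v t := by
  have hp := (continuousOn_primitive_Icc hv).integrableOn_Ioo
  have hm := (hasWeakDeriv_primitive hv).const_mul (-1)
  have := h.add hm hu hv (hp.const_mul _) (hv.const_mul _)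
  obtain ⟨c, hc⟩ := (this.congr (v' := 0) (Filter.EventuallyEq.refl _ _)
    (Filter.Eventually.of_forall fun x => by simp)).ae_eq_const hℓ (hu.add (hp.const_mul _))
  refine ⟨c, ?_⟩
  filter_upwards [hc] with x hx
  simp only [Pi.add_apply] at hx
  linear_combination hx

/-! ### The fundamental solutions of `-u'' = λu` -/

/-- The matrix of the first order system `(u, u')' = (u', -λ u)`. -/
def systemOp (lam : ℂ) : (ℂ × ℂ) →L[ℂ] (ℂ × ℂ) :=
  (ContinuousLinearMap.snd ℂ ℂ ℂ).prod (-lam • ContinuousLinearMap.fst ℂ ℂ ℂ)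

/-- The fundamental solution of the system `(u, u')' = (u', -λ u)`. -/
def fundSol (lam : ℂ) (x : ℝ) : (ℂ × ℂ) →L[ℂ] (ℂ × ℂ) :=
  NormedSpace.exp ((x : ℂ) • systemOp lam)

/-- The solution of `-u'' = λ u` with `u(0) = 1`, `u'(0) = 0`. -/
def cosSol (lam : ℂ) (x : ℝ) : ℂ := (fundSol lam x (1, 0)).1

/-- The solution of `-u'' = λ u` with `u(0) = 0`, `u'(0) = 1`. -/
def sinSol (lam : ℂ) (x : ℝ) : ℂ := (fundSol lam x (0, 1)).1

theorem hasDerivAt_fundSol (lam : ℂ) (x : ℝ) :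
    HasDerivAt (fundSol lam) (fundSol lam x * systemOp lam) x := by
  have := (hasDerivAt_exp_smul_const (𝕂 := ℂ) (systemOp lam) (x : ℂ)).scomp x
    Complex.ofRealCLM.hasDerivAt
  simp only [Complex.ofRealCLM_apply, Complex.ofReal_one, one_smul] at this
  exact this

theorem HasDerivAt.clm_apply_fst {F : ℝ → (ℂ × ℂ) →L[ℂ] (ℂ × ℂ)} {F' : (ℂ × ℂ) →L[ℂ] (ℂ × ℂ)}
    {x : ℝ} (h : HasDerivAt F F' x) (v : ℂ × ℂ) :
    HasDerivAt (fun x => (F x v).1) (F' v).1 x :=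
  ((((ContinuousLinearMap.fst ℂ ℂ ℂ) ∘L (ContinuousLinearMap.apply ℂ (ℂ × ℂ) v)).restrictScalars
    ℝ).hasFDerivAt.comp_hasDerivAt x h)

/-- The derivative of `exp(xA)` is `exp(xA)A`, with `A` acting first. As `A` sends `(0, 1)` to `(1,
0)` and `(1, 0)` to `-λ(0, 1)`, this formula and the next follow. -/
theorem hasDerivAt_sinSol (lam : ℂ) (x : ℝ) : HasDerivAt (sinSol lam) (cosSol lam x) x := by
  have := (hasDerivAt_fundSol lam x).clm_apply_fst (0, 1)
  simp [systemOp] at this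
  exact this

theorem hasDerivAt_cosSol (lam : ℂ) (x : ℝ) : HasDerivAt (cosSol lam) (-lam * sinSol lam x) x := by
  have := (hasDerivAt_fundSol lam x).clm_apply_fst (1, 0)
  have h : ((0, -lam) : ℂ × ℂ) = (-lam) • (0, 1) := by simp
  simp [systemOp, h, -Prod.smul_mk] at this
  rw [neg_mul]
  exact this

theorem fundSol_zero (lam : ℂ) : fundSol lam 0 = 1 := by
  have h : ((0 : ℝ) : ℂ) • systemOp lam = 0 := by ext <;> simp
  rw [fundSol, h, NormedSpace.exp_zero]

theorem cosSol_zero (lam : ℂ) : cosSol lam 0 = 1 := by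
  simp [cosSol, fundSol_zero]

theorem sinSol_zero (lam : ℂ) : sinSol lam 0 = 0 := by
  simp [sinSol, fundSol_zero]

/-- The exponent is affine in `λ` and the exponential is analytic, so no square root of `λ` enters.
-/
theorem analyticAt_fundSol (x : ℝ) (lam : ℂ) : AnalyticAt ℂ (fun lam => fundSol lam x) lam := by
  have h : AnalyticAt ℂ (fun lam => (x : ℂ) • systemOp lam) lam := by
    have : (fun lam : ℂ => (x : ℂ) • systemOp lam) = fun lam =>
        (x : ℂ) • (ContinuousLinearMap.inl ℂ ℂ ℂ ∘L ContinuousLinearMap.snd ℂ ℂ ℂ) +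
        lam • (-(x : ℂ) • (ContinuousLinearMap.inr ℂ ℂ ℂ ∘L ContinuousLinearMap.fst ℂ ℂ ℂ)) := by
      ext <;> simp [systemOp, mul_comm]
    rw [this]
    fun_prop
  exact (NormedSpace.exp_analytic (𝕂 := ℂ) _).comp h

theorem analyticAt_cosSol (x : ℝ) (lam : ℂ) : AnalyticAt ℂ (fun lam => cosSol lam x) lam :=
  (((ContinuousLinearMap.fst ℂ ℂ ℂ) ∘L
    (ContinuousLinearMap.apply ℂ (ℂ × ℂ) ((1, 0) : ℂ × ℂ))).analyticAt (fundSol lam x)).comp (f := fun lam => fundSol lam x)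
      (analyticAt_fundSol x lam)

theorem analyticAt_sinSol (x : ℝ) (lam : ℂ) : AnalyticAt ℂ (fun lam => sinSol lam x) lam :=
  (((ContinuousLinearMap.fst ℂ ℂ ℂ) ∘L
    (ContinuousLinearMap.apply ℂ (ℂ × ℂ) ((0, 1) : ℂ × ℂ))).analyticAt (fundSol lam x)).comp (f := fun lam => fundSol lam x)
      (analyticAt_fundSol x lam)

/-- Each function is, up to a constant factor, the derivative of the other, so the two are treated
in one induction. -/
theorem contDiff_cosSol_sinSol (lam : ℂ) :
    ContDiff ℝ ∞ (cosSol lam) ∧ ContDiff ℝ ∞ (sinSol lam) := by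
  have hc : deriv (cosSol lam) = fun x => -lam * sinSol lam x :=
    funext fun x => (hasDerivAt_cosSol lam x).deriv
  have hs : deriv (sinSol lam) = cosSol lam := funext fun x => (hasDerivAt_sinSol lam x).deriv
  have hcd : Differentiable ℝ (cosSol lam) := fun x => (hasDerivAt_cosSol lam x).differentiableAt
  have hsd : Differentiable ℝ (sinSol lam) := fun x => (hasDerivAt_sinSol lam x).differentiableAt
  have key : ∀ n : ℕ, ContDiff ℝ n (cosSol lam) ∧ ContDiff ℝ n (sinSol lam) := by
    intro n
    induction n with
    | zero => exact ⟨contDiff_zero.2 hcd.continuous, contDiff_zero.2 hsd.continuous⟩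
    | succ n ih =>
      push_cast
      refine ⟨contDiff_succ_iff_deriv.2 ⟨hcd, by simp, ?_⟩,
        contDiff_succ_iff_deriv.2 ⟨hsd, by simp, ?_⟩⟩
      · rw [hc]; exact contDiff_const.mul ih.2
      · rw [hs]; exact ih.1
  exact ⟨contDiff_infty.2 fun n => (key n).1, contDiff_infty.2 fun n => (key n).2⟩

theorem contDiff_cosSol (lam : ℂ) : ContDiff ℝ ∞ (cosSol lam) := (contDiff_cosSol_sinSol lam).1

theorem contDiff_sinSol (lam : ℂ) : ContDiff ℝ ∞ (sinSol lam) := (contDiff_cosSol_sinSol lam).2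

/-- The Wronskian of the two solutions is equal to `1`. -/
theorem cosSol_sq_add (lam : ℂ) (x : ℝ) : cosSol lam x ^ 2 + lam * sinSol lam x ^ 2 = 1 := by
  have hd : ∀ x, HasDerivAt (fun x => cosSol lam x ^ 2 + lam * sinSol lam x ^ 2) 0 x := by
    intro x
    have := ((hasDerivAt_cosSol lam x).pow 2).add (((hasDerivAt_sinSol lam x).pow 2).const_mul lam)
    have h0 : ((2 : ℕ) : ℂ) * cosSol lam x ^ (2 - 1) * (-lam * sinSol lam x) +
        lam * (((2 : ℕ) : ℂ) * sinSol lam x ^ (2 - 1) * cosSol lam x) = 0 := by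
      norm_num; ring
    rw [h0] at this
    exact this
  have := is_const_of_deriv_eq_zero (fun x => (hd x).differentiableAt) (fun x => (hd x).deriv) x 0
  simpa [cosSol_zero, sinSol_zero] using this

/-! ### Completeness of `H²` and boundary values -/

/-- The functional `u ↦ ∫ u φ` on `L²(0, ℓ)`. -/
def L2.integralMul (ℓ : ℝ) (φ : C(ℝ, ℂ)) : L2 ℓ →L[ℂ] ℂ :=
  innerSL ℂ (MemLp.toLp (p := 2) (μ := volume.restrict (Set.Ioo 0 ℓ))
    (fun x => starRingEnd ℂ (φ x)) (by
      obtain ⟨C, hC⟩ := (isCompact_Icc (a := 0) (b := ℓ)).exists_bound_of_continuousOn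
        (f := fun x => starRingEnd ℂ (φ x)) (by fun_prop)
      refine MemLp.of_bound (by fun_prop) C ?_
      rw [ae_restrict_iff' measurableSet_Ioo]
      exact Filter.Eventually.of_forall fun x hx => hC x (Set.Ioo_subset_Icc_self hx)))

theorem L2.integralMul_apply {ℓ : ℝ} (φ : C(ℝ, ℂ)) (u : L2 ℓ) :
    L2.integralMul ℓ φ u = ∫ x in Set.Ioo 0 ℓ, u x * φ x := by
  rw [L2.integralMul, innerSL_apply_apply, L2.inner_def]
  refine integral_congr_ae ?_
  filter_upwards [MemLp.coeFn_toLp (p := 2) (μ := volume.restrict (Set.Ioo 0 ℓ))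
    (f := fun x => starRingEnd ℂ (φ x)) _] with x hx
  rw [hx]
  simp

theorem L2.integrableOn {ℓ : ℝ} (u : L2 ℓ) : IntegrableOn u (Set.Ioo 0 ℓ) :=
  (Lp.memLp u).integrable (by norm_num)

theorem ContinuousOn.memLp_Ioo {ℓ : ℝ} {g : ℝ → ℂ} (hg : ContinuousOn g (Set.Icc 0 ℓ)) :
    MemLp g 2 (volume.restrict (Set.Ioo 0 ℓ)) := by
  obtain ⟨C, hC⟩ := (isCompact_Icc (a := 0) (b := ℓ)).exists_bound_of_continuousOn hg
  refine MemLp.of_bound ((hg.mono Set.Ioo_subset_Icc_self).aestronglyMeasurable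
    measurableSet_Ioo) C ?_
  rw [ae_restrict_iff' measurableSet_Ioo]
  exact Filter.Eventually.of_forall fun x hx => hC x (Set.Ioo_subset_Icc_self hx)

/-- Each test function imposes an equality of two continuous functions. Closedness makes `H²`
complete, as the open mapping theorem requires. -/
theorem isClosed_setOf_isWeakDeriv {X : Type*} [TopologicalSpace X] {ℓ : ℝ} {u v : X → L2 ℓ}
    (hu : Continuous u) (hv : Continuous v) : IsClosed {x | IsWeakDeriv ℓ (u x) (v x)} := by
  have : {x | IsWeakDeriv ℓ (u x) (v x)} = ⋂ (φ : ℝ → ℂ) (hφ : IsTestFun ℓ φ),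
      {x | L2.integralMul ℓ ⟨deriv φ, hφ.contDiff.continuous_deriv (by simp)⟩ (u x) =
        -L2.integralMul ℓ ⟨φ, hφ.contDiff.continuous⟩ (v x)} := by
    ext x
    simp only [Set.mem_iInter, Set.mem_ofPred_eq, L2.integralMul_apply]
    rfl
  rw [this]
  exact isClosed_iInter fun φ => isClosed_iInter fun hφ =>
    isClosed_eq ((ContinuousLinearMap.continuous _).comp hu)
      ((ContinuousLinearMap.continuous _).comp hv).neg

instance H2.instCompleteSpace (ℓ : ℝ) : CompleteSpace (H2 ℓ) := by
  have h : ∀ i, Continuous fun u : PiLp 2 (fun _ : Fin 3 => L2 ℓ) => u i := fun i =>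
    (PiLp.proj 2 (fun _ : Fin 3 => L2 ℓ) i : PiLp 2 (fun _ : Fin 3 => L2 ℓ) →L[ℂ] L2 ℓ).continuous
  have : IsClosed (H2 ℓ : Set (PiLp 2 (fun _ : Fin 3 => L2 ℓ))) :=
    (isClosed_setOf_isWeakDeriv (h 0) (h 1)).inter (isClosed_setOf_isWeakDeriv (h 1) (h 2))
  exact this.completeSpace_coe

namespace H2

variable {ℓ : ℝ}

theorem hasWeakDeriv (u : H2 ℓ) : HasWeakDeriv ℓ (derivL ℓ 0 u) (derivL ℓ 1 u) := u.2.1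

theorem hasWeakDeriv' (u : H2 ℓ) : HasWeakDeriv ℓ (derivL ℓ 1 u) (derivL ℓ 2 u) := u.2.2

theorem exists_of_hasWeakDeriv {g g' g'' : ℝ → ℂ}
    (hg : MemLp g 2 (volume.restrict (Set.Ioo 0 ℓ)))
    (hg' : MemLp g' 2 (volume.restrict (Set.Ioo 0 ℓ)))
    (hg'' : MemLp g'' 2 (volume.restrict (Set.Ioo 0 ℓ)))
    (h : HasWeakDeriv ℓ g g') (h' : HasWeakDeriv ℓ g' g'') :
    ∃ u : H2 ℓ, derivL ℓ 0 u =ᵐ[volume.restrict (Set.Ioo 0 ℓ)] g ∧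
      derivL ℓ 1 u =ᵐ[volume.restrict (Set.Ioo 0 ℓ)] g' ∧
      derivL ℓ 2 u =ᵐ[volume.restrict (Set.Ioo 0 ℓ)] g'' :=
  ⟨⟨WithLp.toLp 2 ![hg.toLp, hg'.toLp, hg''.toLp],
    h.congr hg.coeFn_toLp.symm hg'.coeFn_toLp.symm,
    h'.congr hg'.coeFn_toLp.symm hg''.coeFn_toLp.symm⟩,
    hg.coeFn_toLp, hg'.coeFn_toLp, hg''.coeFn_toLp⟩

theorem eq_zero_of_derivL {u : H2 ℓ} (h0 : derivL ℓ 0 u = 0) (h1 : derivL ℓ 1 u = 0)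
    (h2 : derivL ℓ 2 u = 0) : u = 0 := by
  ext i : 2
  fin_cases i
  exacts [h0, h1, h2]

/-- `g` and `g'` are continuous representatives, on `[0, ℓ]`, of `u` and of its derivative. -/
structure IsRep (u : H2 ℓ) (g g' : ℝ → ℂ) : Prop where
  cont : ContinuousOn g (Set.Icc 0 ℓ)
  cont' : ContinuousOn g' (Set.Icc 0 ℓ)
  ae_eq : derivL ℓ 0 u =ᵐ[volume.restrict (Set.Ioo 0 ℓ)] g
  ae_eq' : derivL ℓ 1 u =ᵐ[volume.restrict (Set.Ioo 0 ℓ)] g'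

end H2

/-- The end points are included, so the vertex values do not depend on the continuous
representative. -/
theorem eqOn_Icc_of_ae_eq_Ioo {ℓ : ℝ} (hℓ : 0 < ℓ) {g k : ℝ → ℂ}
    (h : g =ᵐ[volume.restrict (Set.Ioo 0 ℓ)] k) (hg : ContinuousOn g (Set.Icc 0 ℓ))
    (hk : ContinuousOn k (Set.Icc 0 ℓ)) : Set.EqOn g k (Set.Icc 0 ℓ) := by
  refine Measure.eqOn_Icc_of_ae_eq volume hℓ.ne ?_ hg hk
  rwa [← restrict_Ioo_eq_restrict_Icc]

theorem exists_continuousOn_ae_eq {ℓ : ℝ} (hℓ : 0 < ℓ) {u v : ℝ → ℂ} (h : HasWeakDeriv ℓ u v)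
    (hu : IntegrableOn u (Set.Ioo 0 ℓ)) (hv : IntegrableOn v (Set.Ioo 0 ℓ)) :
    ∃ g, ContinuousOn g (Set.Icc 0 ℓ) ∧ u =ᵐ[volume.restrict (Set.Ioo 0 ℓ)] g := by
  obtain ⟨c, hc⟩ := h.exists_ae_eq hℓ hu hv
  exact ⟨_, continuousOn_const.add (continuousOn_primitive_Icc hv), hc⟩

/-- Integration by parts for a weakly differentiable function. -/
theorem HasWeakDeriv.integral_mul_add {ℓ : ℝ} (hℓ : 0 < ℓ) {u v g φ ψ : ℝ → ℂ}
    (h : HasWeakDeriv ℓ u v) (hu : IntegrableOn u (Set.Ioo 0 ℓ))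
    (hv : IntegrableOn v (Set.Ioo 0 ℓ)) (hg : ContinuousOn g (Set.Icc 0 ℓ))
    (hug : u =ᵐ[volume.restrict (Set.Ioo 0 ℓ)] g) (hφ : ∀ x, HasDerivAt φ (ψ x) x)
    (hψ : Continuous ψ) :
    (∫ x in Set.Ioo 0 ℓ, u x * ψ x) + ∫ x in Set.Ioo 0 ℓ, v x * φ x = g ℓ * φ ℓ - g 0 * φ 0 := by
  obtain ⟨c, hc⟩ := h.exists_ae_eq hℓ hu hv
  have hp := continuousOn_primitive_Icc hv
  have heq := eqOn_Icc_of_ae_eq_Ioo hℓ (hug.symm.trans hc) hg (continuousOn_const.add hp)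
  have e0 : g 0 = c := by simpa using heq (Set.left_mem_Icc.2 hℓ.le)
  have e1 : g ℓ = c + ∫ t in Set.Ioo 0 ℓ, v t := by
    have := heq (Set.right_mem_Icc.2 hℓ.le)
    simp only at this
    rwa [intervalIntegral.integral_of_le hℓ.le, integral_Ioc_eq_integral_Ioo] at this
  have e2 : ∫ x in Set.Ioo 0 ℓ, u x * ψ x = (∫ x in Set.Ioo 0 ℓ, c * ψ x) +
      ∫ x in Set.Ioo 0 ℓ, (∫ t in (0 : ℝ)..x, v t) * ψ x := by
    rw [← integral_add (hψ.continuousOn.integrableOn_Ioo.const_mul c)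
      (integrableOn_mul_continuous hp.integrableOn_Ioo hψ)]
    refine integral_congr_ae ?_
    filter_upwards [hc] with x hx
    rw [hx, add_mul]
  rw [e2, integral_primitive_mul hv hφ hψ, integral_const_mul, e0, e1,
    ← integral_Ioc_eq_integral_Ioo (f := ψ), ← intervalIntegral.integral_of_le hℓ.le,
    intervalIntegral.integral_eq_sub_of_hasDerivAt (fun x _ => hφ x)
      (hψ.intervalIntegrable _ _)]
  ring

namespace H2

variable {ℓ : ℝ}

theorem exists_isRep (hℓ : 0 < ℓ) (u : H2 ℓ) : ∃ g g' : ℝ → ℂ, IsRep u g g' := by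
  obtain ⟨g, hg, h⟩ := exists_continuousOn_ae_eq hℓ (hasWeakDeriv u) (L2.integrableOn _)
    (L2.integrableOn _)
  obtain ⟨g', hg', h'⟩ := exists_continuousOn_ae_eq hℓ (hasWeakDeriv' u) (L2.integrableOn _)
    (L2.integrableOn _)
  exact ⟨g, g', hg, hg', h, h'⟩

/-- The value at `0` of the `i`-th derivative, `i = 0, 1`. -/
def traceLeft (ℓ : ℝ) (i : Fin 2) : H2 ℓ →L[ℂ] ℂ :=
  -(L2.integralMul ℓ ⟨fun _ => -(ℓ : ℂ)⁻¹, by fun_prop⟩ ∘L derivL ℓ i.castSucc +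
    L2.integralMul ℓ ⟨fun x => 1 - (ℓ : ℂ)⁻¹ * x, by fun_prop⟩ ∘L derivL ℓ i.succ)

/-- The value at `ℓ` of the `i`-th derivative, `i = 0, 1`. -/
def traceRight (ℓ : ℝ) (i : Fin 2) : H2 ℓ →L[ℂ] ℂ :=
  L2.integralMul ℓ ⟨fun _ => (ℓ : ℂ)⁻¹, by fun_prop⟩ ∘L derivL ℓ i.castSucc +
    L2.integralMul ℓ ⟨fun x => (ℓ : ℂ)⁻¹ * x, by fun_prop⟩ ∘L derivL ℓ i.succ

/-- Integration by parts against the weight `1 - x/ℓ`, which is `1` at `0` and `0` at `ℓ`, expresses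
the end value through `L²` functionals, whence its boundedness. At the right end the weight is
`x/ℓ`. -/
theorem traceLeft_eq (hℓ : 0 < ℓ) {u : H2 ℓ} {i : Fin 2} {g : ℝ → ℂ}
    (hg : ContinuousOn g (Set.Icc 0 ℓ))
    (h : derivL ℓ i.castSucc u =ᵐ[volume.restrict (Set.Ioo 0 ℓ)] g) :
    traceLeft ℓ i u = g 0 := by
  have hw : HasWeakDeriv ℓ (derivL ℓ i.castSucc u) (derivL ℓ i.succ u) := by
    fin_cases i
    exacts [u.2.1, u.2.2]
  have := hw.integral_mul_add hℓ (L2.integrableOn _) (L2.integrableOn _) hg h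
    (φ := fun x => 1 - (ℓ : ℂ)⁻¹ * x) (ψ := fun _ => -(ℓ : ℂ)⁻¹) (fun x => by
      simpa using (((hasDerivAt_id x).ofReal_comp).const_mul (ℓ : ℂ)⁻¹).const_sub 1) (by fun_prop)
  simp only [traceLeft, neg_apply, add_apply,
    ContinuousLinearMap.comp_apply, L2.integralMul_apply, ContinuousMap.coe_mk]
  have hne : (ℓ : ℂ) ≠ 0 := by exact_mod_cast hℓ.ne'
  rw [this, inv_mul_cancel₀ hne]
  simp

theorem traceRight_eq (hℓ : 0 < ℓ) {u : H2 ℓ} {i : Fin 2} {g : ℝ → ℂ}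
    (hg : ContinuousOn g (Set.Icc 0 ℓ))
    (h : derivL ℓ i.castSucc u =ᵐ[volume.restrict (Set.Ioo 0 ℓ)] g) :
    traceRight ℓ i u = g ℓ := by
  have hw : HasWeakDeriv ℓ (derivL ℓ i.castSucc u) (derivL ℓ i.succ u) := by
    fin_cases i
    exacts [u.2.1, u.2.2]
  have := hw.integral_mul_add hℓ (L2.integrableOn _) (L2.integrableOn _) hg h
    (φ := fun x => (ℓ : ℂ)⁻¹ * x) (ψ := fun _ => (ℓ : ℂ)⁻¹) (fun x => by
      simpa using ((hasDerivAt_id x).ofReal_comp).const_mul (ℓ : ℂ)⁻¹) (by fun_prop)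
  simp only [traceRight, add_apply,
    ContinuousLinearMap.comp_apply, L2.integralMul_apply, ContinuousMap.coe_mk]
  have hne : (ℓ : ℂ) ≠ 0 := by exact_mod_cast hℓ.ne'
  rw [this, inv_mul_cancel₀ hne]
  simp

end H2

/-! ### The Cauchy problem on one edge -/

theorem neg_sub_smul_ae {ℓ : ℝ} (lam : ℂ) (v w : L2 ℓ) :
    (-v - lam • w : L2 ℓ) =ᵐ[volume.restrict (Set.Ioo 0 ℓ)] fun x => -v x - lam * w x := by
  filter_upwards [Lp.coeFn_sub (-v) (lam • w), Lp.coeFn_neg v, Lp.coeFn_smul lam w]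
    with x h1 h2 h3
  rw [h1, Pi.sub_apply, h2, h3]
  simp

namespace H2

variable {ℓ : ℝ}

/-- A solution of `-u'' = λ u` is given by its Cauchy data at `0`. -/
theorem IsRep.eqOn_of_homogeneous (hℓ : 0 < ℓ) {lam : ℂ} {u : H2 ℓ} {g g' : ℝ → ℂ}
    (hr : IsRep u g g') (hu : -derivL ℓ 2 u - lam • derivL ℓ 0 u = 0) :
    Set.EqOn g (fun x => g 0 * cosSol lam x + g' 0 * sinSol lam x) (Set.Icc 0 ℓ) ∧
    Set.EqOn g' (fun x => g 0 * (-lam * sinSol lam x) + g' 0 * cosSol lam x) (Set.Icc 0 ℓ) := by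
  have hC := contDiff_cosSol lam
  have hS := contDiff_sinSol lam
  have hCd := hasDerivAt_cosSol lam
  have hSd := hasDerivAt_sinSol lam
  have h2 : (derivL ℓ 2 u : ℝ → ℂ) =ᵐ[volume.restrict (Set.Ioo 0 ℓ)]
      fun x => -lam * derivL ℓ 0 u x := by
    have h0 := Lp.coeFn_zero ℂ 2 (volume.restrict (Set.Ioo 0 ℓ))
    rw [← hu] at h0
    filter_upwards [h0, neg_sub_smul_ae lam (derivL ℓ 2 u) (derivL ℓ 0 u)] with x h3 h4
    rw [h3, Pi.zero_apply] at h4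
    linear_combination h4
  set u0 := derivL ℓ 0 u with hu0
  set u1 := derivL ℓ 1 u with hu1
  set u2 := derivL ℓ 2 u with hu2
  have i0 := L2.integrableOn u0
  have i1 := L2.integrableOn u1
  have i2 := L2.integrableOn u2
  have hS'c : Continuous fun x => -lam * sinSol lam x := continuous_const.mul hS.continuous
  have w0C := (hasWeakDeriv u).mul_smooth i0 i1 hC hCd
  have w0S := (hasWeakDeriv u).mul_smooth i0 i1 hS hSd
  have w1C := (hasWeakDeriv' u).mul_smooth i1 i2 hC hCd
  have w1S := (hasWeakDeriv' u).mul_smooth i1 i2 hS hSd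
  have j0C := integrableOn_mul_continuous i0 hC.continuous
  have j0S := integrableOn_mul_continuous i0 hS.continuous
  have j1C := integrableOn_mul_continuous i1 hC.continuous
  have j1S := integrableOn_mul_continuous i1 hS.continuous
  have j2C := integrableOn_mul_continuous i2 hC.continuous
  have j2S := integrableOn_mul_continuous i2 hS.continuous
  have j0C' := integrableOn_mul_continuous i0 hS'c
  have j1C' := integrableOn_mul_continuous i1 hS'c
  -- With `C`, `S` the two fundamental solutions, `α = uC - u'S` and `β = λuS + u'C` have weak
  -- derivative zero, so they are constant. The identity `C² + λS² = 1` inverts these relations to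
  -- `u = αC + βS` and `u' = -λαS + βC`.
  obtain ⟨α, hα⟩ := ((w0C.add (w1S.const_mul (-1)) j0C (j1C.add j0C') (j1S.const_mul _)
    ((j2S.add j1C).const_mul _)).congr (v' := 0) Filter.EventuallyEq.rfl (by
      filter_upwards [h2] with x hx
      simp only [Pi.add_apply, Pi.zero_apply]
      linear_combination (-sinSol lam x) * hx)).ae_eq_const hℓ (j0C.add (j1S.const_mul _))
  obtain ⟨β, hβ⟩ := (((w0S.const_mul lam).add w1C (j0S.const_mul _)
    ((j1S.add j0C).const_mul _) j1C (j2C.add j1C')).congr (v' := 0) Filter.EventuallyEq.rfl (by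
      filter_upwards [h2] with x hx
      simp only [Pi.add_apply, Pi.zero_apply]
      linear_combination cosSol lam x * hx)).ae_eq_const hℓ ((j0S.const_mul _).add j1C)
  have eg := eqOn_Icc_of_ae_eq_Ioo hℓ (k := fun x => α * cosSol lam x + β * sinSol lam x) (by
    filter_upwards [hr.ae_eq, hα, hβ] with x h1 h3 h4
    rw [← h1, ← h3, ← h4]
    simp only [Pi.add_apply]
    linear_combination (-u0 x) * cosSol_sq_add lam x) hr.cont
    ((continuous_const.mul hC.continuous).add (continuous_const.mul hS.continuous)).continuousOn
  have eg' := eqOn_Icc_of_ae_eq_Ioo hℓ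
    (k := fun x => α * (-lam * sinSol lam x) + β * cosSol lam x) (by
    filter_upwards [hr.ae_eq', hα, hβ] with x h1 h3 h4
    rw [← h1, ← h3, ← h4]
    simp only [Pi.add_apply]
    linear_combination (-u1 x) * cosSol_sq_add lam x) hr.cont'
    ((continuous_const.mul hS'c).add (continuous_const.mul hC.continuous)).continuousOn
  have ha : g 0 = α := by
    simpa [cosSol_zero, sinSol_zero] using eg (Set.left_mem_Icc.2 hℓ.le)
  have hb : g' 0 = β := by
    simpa [cosSol_zero, sinSol_zero] using eg' (Set.left_mem_Icc.2 hℓ.le)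
  rw [ha, hb]
  exact ⟨eg, eg'⟩

/-- The Cauchy problem for `-u'' - λ u = f` is solvable. -/
theorem exists_isRep_cauchy (hℓ : 0 < ℓ) (lam : ℂ) (f : L2 ℓ) (a b : ℂ) :
    ∃ (u : H2 ℓ) (g g' : ℝ → ℂ), IsRep u g g' ∧ -derivL ℓ 2 u - lam • derivL ℓ 0 u = f ∧
      g 0 = a ∧ g' 0 = b := by
  have hC := contDiff_cosSol lam
  have hS := contDiff_sinSol lam
  have hCd := hasDerivAt_cosSol lam
  have hSd := hasDerivAt_sinSol lam
  have hf := L2.integrableOn f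
  have fS := integrableOn_mul_continuous hf hS.continuous
  have fC := (integrableOn_mul_continuous hf hC.continuous).const_mul (-1)
  have hS' : ContDiff ℝ ∞ fun x => -lam * sinSol lam x := contDiff_const.mul hS
  have hS'd : ∀ x, HasDerivAt (fun x => -lam * sinSol lam x) (-lam * cosSol lam x) x :=
    fun x => (hSd x).const_mul _
  have hprim : ∀ {h : ℝ → ℂ}, IntegrableOn h (Set.Ioo 0 ℓ) → ∀ c : ℂ,
      ∃ z : ℝ → ℂ, ContinuousOn z (Set.Icc 0 ℓ) ∧ z 0 = c ∧ HasWeakDeriv ℓ z h := by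
    intro h hh c
    have hp := continuousOn_primitive_Icc hh
    refine ⟨fun x => c + ∫ t in (0 : ℝ)..x, h t, continuousOn_const.add hp, by simp, ?_⟩
    have := (hasWeakDeriv_const hℓ c).add (hasWeakDeriv_primitive hh)
      continuousOn_const.integrableOn_Ioo (integrableOn_zero) hp.integrableOn_Ioo hh
    rwa [zero_add] at this
  -- Variation of constants: `u = zC + wS` with `z' = fS`, `w' = -fC`. Then `z'C + w'S = 0`, and `C²
  -- + λS² = 1` turns the remaining term of `u''` into `-f`.
  obtain ⟨z, hz, hz0, hzw⟩ := hprim fS a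
  obtain ⟨w, hw, hw0, hww⟩ := hprim fC b
  have iz := hz.integrableOn_Ioo
  have iw := hw.integrableOn_Ioo
  have hg : ContinuousOn (fun x => z x * cosSol lam x + w x * sinSol lam x) (Set.Icc 0 ℓ) :=
    (hz.mul hC.continuous.continuousOn).add (hw.mul hS.continuous.continuousOn)
  have hg' : ContinuousOn (fun x => z x * (-lam * sinSol lam x) + w x * cosSol lam x)
      (Set.Icc 0 ℓ) :=
    (hz.mul hS'.continuous.continuousOn).add (hw.mul hC.continuous.continuousOn)
  have d1 := (hzw.mul_smooth iz fS hC hCd).add (hww.mul_smooth iw fC hS hSd)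
    (integrableOn_mul_continuous iz hC.continuous)
    ((integrableOn_mul_continuous fS hC.continuous).add
      (integrableOn_mul_continuous iz hS'.continuous))
    (integrableOn_mul_continuous iw hS.continuous)
    ((integrableOn_mul_continuous fC hS.continuous).add
      (integrableOn_mul_continuous iw hC.continuous))
  have d2 := (hzw.mul_smooth iz fS hS' hS'd).add (hww.mul_smooth iw fC hC hCd)
    (integrableOn_mul_continuous iz hS'.continuous)
    ((integrableOn_mul_continuous fS hS'.continuous).add
      (integrableOn_mul_continuous iz (continuous_const.mul hC.continuous)))
    (integrableOn_mul_continuous iw hC.continuous)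
    ((integrableOn_mul_continuous fC hC.continuous).add
      (integrableOn_mul_continuous iw hS'.continuous))
  have m2 : MemLp (fun x => -f x - lam * (z x * cosSol lam x + w x * sinSol lam x)) 2
      (volume.restrict (Set.Ioo 0 ℓ)) := (Lp.memLp f).neg.sub (hg.memLp_Ioo.const_mul lam)
  obtain ⟨u, h0, h1, h2⟩ := exists_of_hasWeakDeriv hg.memLp_Ioo hg'.memLp_Ioo m2
    (d1.congr Filter.EventuallyEq.rfl (Filter.Eventually.of_forall fun x => by
      simp only [Pi.add_apply]; ring))
    (d2.congr Filter.EventuallyEq.rfl (Filter.Eventually.of_forall fun x => by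
      simp only [Pi.add_apply]; linear_combination (-f x) * cosSol_sq_add lam x))
  refine ⟨u, _, _, ⟨hg, hg', h0, h1⟩, ?_, ?_, ?_⟩
  · apply Lp.ext
    filter_upwards [neg_sub_smul_ae lam (derivL ℓ 2 u) (derivL ℓ 0 u), h0, h2] with x e1 e2 e3
    rw [e1, e2, e3]
    ring
  · simp [cosSol_zero, sinSol_zero, hz0]
  · simp [cosSol_zero, sinSol_zero, hw0]

end H2

/-! ### Invertibility of `L(P) - λ` as transversality -/

section Graph

instance GraphH2.instNormedAddCommGroup {E : Type*} [Fintype E] (len : E → ℝ) :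
    NormedAddCommGroup (GraphH2 len) := PiLp.normedAddCommGroup 2 _

instance GraphH2.instNormedSpace {E : Type*} [Fintype E] (len : E → ℝ) :
    NormedSpace ℂ (GraphH2 len) := PiLp.normedSpace 2 ℂ _

instance GraphL2.instNormedAddCommGroup {E : Type*} [Fintype E] (len : E → ℝ) :
    NormedAddCommGroup (GraphL2 len) := PiLp.normedAddCommGroup 2 _

instance GraphL2.instNormedSpace {E : Type*} [Fintype E] (len : E → ℝ) :
    NormedSpace ℂ (GraphL2 len) := PiLp.normedSpace 2 ℂ _

instance GraphH2.instCompleteSpace {E : Type*} [Fintype E] (len : E → ℝ) :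
    CompleteSpace (GraphH2 len) := PiLp.completeSpace 2 _

instance GraphL2.instCompleteSpace {E : Type*} [Fintype E] (len : E → ℝ) :
    CompleteSpace (GraphL2 len) := PiLp.completeSpace 2 _

instance domainH.instNormedAddCommGroup {E : Type*} [Fintype E] (len : E → ℝ)
    (P : Submodule ℂ (VertexSpace E)) : NormedAddCommGroup (domainH len P) :=
  Submodule.normedAddCommGroup _

instance domainH.instNormedSpace {E : Type*} [Fintype E] (len : E → ℝ)
    (P : Submodule ℂ (VertexSpace E)) : NormedSpace ℂ (domainH len P) := Submodule.normedSpace _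

variable {E : Type*} [Fintype E] (len : E → ℝ)

/-- The vector of vertex values as a bounded operator. -/
def vertexTrace : GraphH2 len →L[ℂ] VertexSpace E :=
  ContinuousLinearMap.pi fun p =>
    (![H2.traceLeft (len p.1) 0, H2.traceLeft (len p.1) 1, H2.traceRight (len p.1) 0,
      -H2.traceRight (len p.1) 1] p.2) ∘L PiLp.proj 2 (fun e : E => H2 (len e)) p.1

variable {len}

omit [Fintype E] in
theorem IsContRep.isRep {u : GraphH2 len} {g g' : E → ℝ → ℂ} (h : IsContRep u g g') (e : E) :
    H2.IsRep (u e) (g e) (g' e) :=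
  ⟨h.cont e, h.cont' e, h.ae_eq e, h.ae_eq' e⟩

omit [Fintype E] in
theorem isContRep_of_isRep {u : GraphH2 len} {g g' : E → ℝ → ℂ}
    (h : ∀ e, H2.IsRep (u e) (g e) (g' e)) : IsContRep u g g' :=
  ⟨fun e => (h e).cont, fun e => (h e).cont', fun e => (h e).ae_eq, fun e => (h e).ae_eq'⟩

omit [Fintype E] in
theorem exists_isContRep (hlen : ∀ e, 0 < len e) (u : GraphH2 len) :
    ∃ g g' : E → ℝ → ℂ, IsContRep u g g' := by
  choose g g' h using fun e => H2.exists_isRep (hlen e) (u e)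
  exact ⟨g, g', isContRep_of_isRep h⟩

omit [Fintype E] in
theorem IsContRep.vertexValues_eq (hlen : ∀ e, 0 < len e) {u : GraphH2 len} {g g' : E → ℝ → ℂ}
    (h : IsContRep u g g') : vertexValues len g g' = vertexTrace len u := by
  ext ⟨e, i⟩
  fin_cases i
  · exact (H2.traceLeft_eq (hlen e) (i := 0) (h.cont e) (h.ae_eq e)).symm
  · exact (H2.traceLeft_eq (hlen e) (i := 1) (h.cont' e) (h.ae_eq' e)).symm
  · exact (H2.traceRight_eq (hlen e) (i := 0) (h.cont e) (h.ae_eq e)).symm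
  · exact congrArg Neg.neg (H2.traceRight_eq (hlen e) (i := 1) (h.cont' e) (h.ae_eq' e)).symm

-- Representatives exist and their end values are unique, so membership in `H(P)` becomes a
-- condition on one bounded operator.
omit [Fintype E] in
theorem mem_domainH_iff (hlen : ∀ e, 0 < len e) {P : Submodule ℂ (VertexSpace E)}
    {u : GraphH2 len} : u ∈ domainH len P ↔ vertexTrace len u ∈ P := by
  constructor
  · rintro ⟨g, g', h, hP⟩
    rwa [← h.vertexValues_eq hlen]
  · intro hP
    obtain ⟨g, g', h⟩ := exists_isContRep hlen u
    exact ⟨g, g', h, by rwa [h.vertexValues_eq hlen]⟩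

theorem completeSpace_domainH (hlen : ∀ e, 0 < len e) (P : Submodule ℂ (VertexSpace E)) :
    CompleteSpace (domainH len P) := by
  have : IsClosed (domainH len P : Set (GraphH2 len)) := by
    have h : (domainH len P : Set (GraphH2 len)) = vertexTrace len ⁻¹' P := by
      ext u
      exact mem_domainH_iff hlen
    rw [h]
    exact P.closed_of_finiteDimensional.preimage (vertexTrace len).continuous
  exact this.completeSpace_coe

variable (len) in
/-- The vertex values of the solution of `-u'' = λ u` with given Cauchy data `(u(0), u'(0))` on each
edge. -/
def cauchyMap (lam : ℂ) : (E × Fin 2 → ℂ) →ₗ[ℂ] VertexSpace E where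
  -- The last entries carry the sign of `-u'(ℓ)`, the derivative into the edge.
  toFun c p := c (p.1, 0) * ![1, 0, cosSol lam (len p.1), lam * sinSol lam (len p.1)] p.2 +
    c (p.1, 1) * ![0, 1, sinSol lam (len p.1), -cosSol lam (len p.1)] p.2
  map_add' c d := by ext p; simp only [Pi.add_apply]; ring
  map_smul' a c := by ext p; simp only [Pi.smul_apply, smul_eq_mul, RingHom.id_apply]; ring

-- The first two vertex values on each edge are the Cauchy data themselves.
omit [Fintype E] in
theorem cauchyMap_injective (lam : ℂ) : Function.Injective (cauchyMap len lam) := by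
  rw [← LinearMap.ker_eq_bot, LinearMap.ker_eq_bot']
  intro c hc
  ext ⟨e, i⟩
  have h0 := congrFun hc (e, 0)
  have h1 := congrFun hc (e, 1)
  fin_cases i
  · simpa [cauchyMap] using h0
  · simpa [cauchyMap] using h1

theorem shiftedOp_apply (P : Submodule ℂ (VertexSpace E)) (lam : ℂ) (u : domainH len P) (e : E) :
    shiftedOp len P lam u e =
      -H2.derivL (len e) 2 (u.1 e) - lam • H2.derivL (len e) 0 (u.1 e) := rfl

omit [Fintype E] in
/-- The Cauchy problem on all the edges. -/
theorem exists_isContRep_cauchy (hlen : ∀ e, 0 < len e) (lam : ℂ) (f : GraphL2 len)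
    (c : E × Fin 2 → ℂ) :
    ∃ (u : GraphH2 len) (g g' : E → ℝ → ℂ), IsContRep u g g' ∧
      (∀ e, -H2.derivL (len e) 2 (u e) - lam • H2.derivL (len e) 0 (u e) = f e) ∧
      ∀ e, g e 0 = c (e, 0) ∧ g' e 0 = c (e, 1) := by
  choose u g g' h using fun e => H2.exists_isRep_cauchy (hlen e) lam (f e) (c (e, 0)) (c (e, 1))
  exact ⟨WithLp.toLp 2 u, g, g', isContRep_of_isRep fun e => (h e).1, fun e => (h e).2.1,
    fun e => (h e).2.2⟩

omit [Fintype E] in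
theorem IsContRep.vertexValues_of_homogeneous (hlen : ∀ e, 0 < len e) {lam : ℂ}
    {u : GraphH2 len} {g g' : E → ℝ → ℂ} (h : IsContRep u g g')
    (hu : ∀ e, -H2.derivL (len e) 2 (u e) - lam • H2.derivL (len e) 0 (u e) = 0) :
    vertexValues len g g' = cauchyMap len lam fun k => ![g k.1 0, g' k.1 0] k.2 := by
  ext ⟨e, i⟩
  obtain ⟨h1, h2⟩ := (h.isRep e).eqOn_of_homogeneous (hlen e) (hu e)
  have hm := Set.right_mem_Icc.2 (hlen e).le
  have e1 := h1 hm
  have e2 := h2 hm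
  simp only at e1 e2
  fin_cases i
  · simp [vertexValues, cauchyMap]
  · simp [vertexValues, cauchyMap]
  · simp [vertexValues, cauchyMap, e1]
  · simp [vertexValues, cauchyMap, e2, add_comm]

omit [Fintype E] in
/-- The solution of the homogeneous equation with given Cauchy data. -/
theorem exists_homogeneous (hlen : ∀ e, 0 < len e) (lam : ℂ) (c : E × Fin 2 → ℂ) :
    ∃ u : GraphH2 len,
      (∀ e, -H2.derivL (len e) 2 (u e) - lam • H2.derivL (len e) 0 (u e) = 0) ∧
      vertexTrace len u = cauchyMap len lam c := by
  obtain ⟨u, g, g', hr, hu, hc⟩ := exists_isContRep_cauchy hlen lam 0 c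
  refine ⟨u, hu, ?_⟩
  rw [← hr.vertexValues_eq hlen, hr.vertexValues_of_homogeneous hlen hu]
  congr 1
  ext ⟨e, i⟩
  fin_cases i
  · exact (hc e).1
  · exact (hc e).2

omit [Fintype E] in
theorem eq_zero_of_homogeneous (hlen : ∀ e, 0 < len e) {lam : ℂ}
    {u : GraphH2 len} {g g' : E → ℝ → ℂ} (h : IsContRep u g g')
    (hu : ∀ e, -H2.derivL (len e) 2 (u e) - lam • H2.derivL (len e) 0 (u e) = 0)
    (h0 : ∀ e, g e 0 = 0 ∧ g' e 0 = 0) : u = 0 := by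
  ext e : 1
  obtain ⟨h1, h2⟩ := (h.isRep e).eqOn_of_homogeneous (hlen e) (hu e)
  have z0 : H2.derivL (len e) 0 (u e) = 0 := by
    rw [Lp.eq_zero_iff_ae_eq_zero]
    filter_upwards [h.ae_eq e, ae_restrict_mem measurableSet_Ioo] with x hx hm
    rw [hx, h1 (Set.Ioo_subset_Icc_self hm)]
    simp [h0]
  have z1 : H2.derivL (len e) 1 (u e) = 0 := by
    rw [Lp.eq_zero_iff_ae_eq_zero]
    filter_upwards [h.ae_eq' e, ae_restrict_mem measurableSet_Ioo] with x hx hm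
    rw [hx, h2 (Set.Ioo_subset_Icc_self hm)]
    simp [h0]
  have z2 : H2.derivL (len e) 2 (u e) = 0 := by
    have := hu e
    rwa [z0, smul_zero, sub_zero, neg_eq_zero] at this
  exact H2.eq_zero_of_derivL z0 z1 z2

/-- A vector common to `P` and `N(λ)` is the trace of a homogeneous solution, which then lies in
`H(P)` and in the kernel. -/
theorem disjoint_of_shiftedOp_injective (hlen : ∀ e, 0 < len e)
    {P : Submodule ℂ (VertexSpace E)} {lam : ℂ}
    (hinj : ∀ u, shiftedOp len P lam u = 0 → u = 0) :
    Disjoint P (LinearMap.range (cauchyMap len lam)) := by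
  rw [Submodule.disjoint_def]
  rintro _ hw ⟨c, rfl⟩
  obtain ⟨u, hu, hv⟩ := exists_homogeneous hlen lam c
  have hmem : u ∈ domainH len P := (mem_domainH_iff hlen).2 (by rwa [hv])
  have h0 : u = 0 := congrArg Subtype.val (hinj ⟨u, hmem⟩ (by ext e : 1; exact hu e))
  rw [← hv, h0]
  exact (vertexTrace len).map_zero

theorem shiftedOp_injective (hlen : ∀ e, 0 < len e) {P : Submodule ℂ (VertexSpace E)} {lam : ℂ}
    (hd : Disjoint P (LinearMap.range (cauchyMap len lam))) {u : domainH len P}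
    (hu : shiftedOp len P lam u = 0) : u = 0 := by
  obtain ⟨u, hmem⟩ := u
  obtain ⟨g, g', hr, hv⟩ := hmem
  have hu' : ∀ e, -H2.derivL (len e) 2 (u e) - lam • H2.derivL (len e) 0 (u e) = 0 :=
    fun e => congrArg (fun f : GraphL2 len => f e) hu
  have hvv := hr.vertexValues_of_homogeneous hlen hu'
  have h0 := Submodule.disjoint_def.1 hd _ hv ⟨_, hvv.symm⟩
  rw [hvv] at h0
  have hc := cauchyMap_injective lam (h0.trans (map_zero (cauchyMap len lam)).symm)
  exact Subtype.ext (eq_zero_of_homogeneous hlen hr hu' fun e =>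
    ⟨congrFun hc (e, 0), congrFun hc (e, 1)⟩)

/-- Solve with zero Cauchy data, split the trace along `P + N(λ)`, and subtract the homogeneous
solution whose trace is the `N(λ)` component. -/
theorem shiftedOp_surjective (hlen : ∀ e, 0 < len e) {P : Submodule ℂ (VertexSpace E)} {lam : ℂ}
    (htop : P ⊔ LinearMap.range (cauchyMap len lam) = ⊤) (f : GraphL2 len) :
    ∃ u, shiftedOp len P lam u = f := by
  obtain ⟨u, g, g', hr, hu, -⟩ := exists_isContRep_cauchy hlen lam f 0
  obtain ⟨p, hp, _, ⟨c, rfl⟩, hs⟩ := Submodule.mem_sup.1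
    (htop ▸ Submodule.mem_top : vertexTrace len u ∈ P ⊔ LinearMap.range (cauchyMap len lam))
  obtain ⟨w, hw, hv⟩ := exists_homogeneous hlen lam c
  have ht : vertexTrace len (u - w) = p := by
    rw [(vertexTrace len).map_sub, hv, ← hs, add_sub_cancel_right]
  refine ⟨⟨u - w, (mem_domainH_iff hlen).2 (ht ▸ hp)⟩, ?_⟩
  ext e : 1
  have e1 := hu e
  have e2 := hw e
  refine (shiftedOp_apply P lam _ e).trans ?_
  have hsub : (u - w) e = u e - w e := rfl
  have hz : ((0 : GraphL2 len) e : L2 (len e)) = 0 := rfl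
  rw [hsub, (H2.derivL (len e) 2).map_sub, (H2.derivL (len e) 0).map_sub, smul_sub, ← e1]
  rw [sub_eq_zero] at e2
  rw [← e2]
  abel

theorem shiftedOp_isInvertible_iff (hlen : ∀ e, 0 < len e) {P : Submodule ℂ (VertexSpace E)}
    (hP : Module.finrank ℂ P = 2 * Fintype.card E) (lam : ℂ) :
    (shiftedOp len P lam).IsInvertible ↔ Disjoint P (LinearMap.range (cauchyMap len lam)) := by
  constructor
  · rintro ⟨A, hA⟩
    refine disjoint_of_shiftedOp_injective hlen fun u hu => ?_
    rw [← hA] at hu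
    exact A.map_eq_zero_iff.1 hu
  · intro hd
    have hN : Module.finrank ℂ (LinearMap.range (cauchyMap len lam)) = 2 * Fintype.card E := by
      rw [LinearMap.finrank_range_of_inj (cauchyMap_injective lam)]
      simp [mul_comm]
    -- Here the choice of `2|E|` matters: it is half the dimension, so disjointness forces the sum
    -- to be everything.
    have htop : P ⊔ LinearMap.range (cauchyMap len lam) = ⊤ := by
      apply Submodule.eq_top_of_disjoint _ _ _ hd
      rw [hP, hN]
      simp
      lia
    have := completeSpace_domainH hlen P
    have hker : (shiftedOp len P lam).ker = ⊥ :=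
      LinearMap.ker_eq_bot'.2 fun u hu => shiftedOp_injective hlen hd hu
    have hran : (shiftedOp len P lam).range = ⊤ :=
      LinearMap.range_eq_top.2 fun f => shiftedOp_surjective hlen htop f
    exact ⟨ContinuousLinearEquiv.ofBijective (shiftedOp len P lam) hker hran,
      ContinuousLinearEquiv.coe_ofBijective _ hker hran⟩

end Graph

/-! ### Transversality through determinants -/

section PairDet

variable {ι κ : Type*} [Fintype ι] [DecidableEq ι] (σ : κ ≃ ι ⊕ ι)

/-- The determinant of the family formed by the vectors `b` and `n` of `κ → ℂ`. -/
def pairDet (b n : ι → κ → ℂ) : ℂ :=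
  -- `σ` only makes the matrix square; another choice permutes the columns.
  (Matrix.of fun j i => Sum.elim b n j (σ.symm i)).det

variable {σ}

theorem pairDet_ne_zero_iff {b n : ι → κ → ℂ} (hb : LinearIndependent ℂ b)
    (hn : LinearIndependent ℂ n) : pairDet σ b n ≠ 0 ↔
      Disjoint (Submodule.span ℂ (Set.range b)) (Submodule.span ℂ (Set.range n)) := by
  have h1 : LinearIndependent ℂ (Sum.elim b n) ↔
      Disjoint (Submodule.span ℂ (Set.range b)) (Submodule.span ℂ (Set.range n)) := by
    rw [linearIndependent_sum]
    simp [Sum.elim_comp_inl, Sum.elim_comp_inr, hb, hn]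
  rw [← h1, pairDet, ← isUnit_iff_ne_zero, ← Matrix.isUnit_iff_isUnit_det,
    ← Matrix.linearIndependent_rows_iff_isUnit]
  exact (LinearMap.linearIndependent_iff_of_injOn
    (LinearEquiv.funCongrLeft ℂ ℂ σ.symm : (κ → ℂ) →ₗ[ℂ] (ι ⊕ ι → ℂ))
    (LinearEquiv.injective _).injOn)

/-- Passing from `b` to `b'` is left multiplication by a block diagonal matrix with identity lower
block. What matters is that the factor `d` does not depend on `n`, so that it cancels in quotients.
-/
theorem exists_pairDet_eq_mul {b b' : ι → κ → ℂ}
    (h : Set.range b' ⊆ Submodule.span ℂ (Set.range b)) :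
    ∃ d : ℂ, ∀ n, pairDet σ b' n = d * pairDet σ b n := by
  have h' : ∀ j, ∃ g : ι → ℂ, ∑ k, g k • b k = b' j := fun j =>
    Submodule.mem_span_range_iff_exists_fun ℂ |>.1 (h ⟨j, rfl⟩)
  choose g hg using h'
  refine ⟨(Matrix.of g).det, fun n => ?_⟩
  have hM : (Matrix.of fun j i => Sum.elim b' n j (σ.symm i)) =
      Matrix.fromBlocks (Matrix.of g) 0 0 1 *
        (Matrix.of fun j i => Sum.elim b n j (σ.symm i)) := by
    ext j i
    rw [Matrix.mul_apply, Fintype.sum_sum_type]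
    cases j with
    | inl j =>
      rw [Matrix.of_apply, Sum.elim_inl, ← hg j]
      simp
    | inr j => simp [Matrix.one_apply]
  rw [pairDet, hM, Matrix.det_mul, Matrix.det_fromBlocks_zero₂₁, Matrix.det_one, mul_one]
  rfl

/-- The quotient of two determinants depends only on the subspace spanned by `b`. -/
theorem pairDet_div_congr {b b' : ι → κ → ℂ}
    (h : Submodule.span ℂ (Set.range b) = Submodule.span ℂ (Set.range b')) (n q : ι → κ → ℂ) :
    pairDet σ b n / pairDet σ b q = pairDet σ b' n / pairDet σ b' q := by
  obtain ⟨d, hd⟩ := exists_pairDet_eq_mul (σ := σ) (b := b') (b' := b) (h ▸ Submodule.subset_span)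
  obtain ⟨d', hd'⟩ :=
    exists_pairDet_eq_mul (σ := σ) (b := b) (b' := b') (h ▸ Submodule.subset_span)
  -- Independence is not assumed. If `d = 0`, all four determinants vanish and both quotients are `0
  -- / 0 = 0`.
  by_cases h0 : d = 0
  · rw [hd' n, hd' q, hd n, hd q, h0]
    simp
  · rw [hd n, hd q, mul_div_mul_left _ _ h0]

theorem analyticAt_pairDet {X : Type*} [NormedAddCommGroup X] [NormedSpace ℂ X]
    {b n : X → ι → κ → ℂ} {x : X} (hb : ∀ j i, AnalyticAt ℂ (fun x => b x j i) x)
    (hn : ∀ j i, AnalyticAt ℂ (fun x => n x j i) x) :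
    AnalyticAt ℂ (fun x => pairDet σ (b x) (n x)) x := by
  simp only [pairDet, Matrix.det_apply']
  refine Finset.analyticAt_fun_sum _ fun τ _ => ?_
  refine analyticAt_const.mul (Finset.analyticAt_fun_prod _ fun i _ => ?_)
  simp only [Matrix.of_apply]
  cases τ i with
  | inl j => exact hb j _
  | inr j => exact hn j _

end PairDet

/-! ### Analytic equations on the Grassmannian -/

namespace Gr

section Basis

variable {ι κ : Type*} [Fintype ι] [Fintype κ] {k : ℕ}

/-- A basis of the subspace `p`. -/
def basis (hk : k = Fintype.card ι) (p : Gr k (κ → ℂ)) : Module.Basis ι ℂ p.1 :=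
  (Module.finBasisOfFinrankEq ℂ p.1 (p.2.trans hk)).reindex (Fintype.equivFin ι).symm

/-- The vectors of a basis of the subspace `p`. -/
def basisVec (hk : k = Fintype.card ι) (p : Gr k (κ → ℂ)) (j : ι) : κ → ℂ := basis hk p j

theorem linearIndependent_basisVec (hk : k = Fintype.card ι) (p : Gr k (κ → ℂ)) :
    LinearIndependent ℂ (basisVec hk p) :=
  (basis hk p).linearIndependent.map' p.1.subtype p.1.ker_subtype

theorem span_basisVec (hk : k = Fintype.card ι) (p : Gr k (κ → ℂ)) :
    Submodule.span ℂ (Set.range (basisVec hk p)) = p.1 := by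
  have : Set.range (basisVec hk p) = p.1.subtype '' Set.range (basis hk p) := by
    rw [← Set.range_comp]; rfl
  rw [this, Submodule.span_image, (basis hk p).span_eq, Submodule.map_top, Submodule.range_subtype]

/-- The vectors of a basis of the graph of `A`, for a fixed basis of the centre of the chart. -/
def Chart.graphVec (hk : k = Fintype.card ι) (c : Chart k (κ → ℂ)) (A : c.Coord) (j : ι) : κ → ℂ :=
  c.graphMap A (basis hk ⟨c.base, c.finrank_base⟩ j)

theorem Chart.span_graphVec (hk : k = Fintype.card ι) (c : Chart k (κ → ℂ)) (A : c.Coord) :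
    Submodule.span ℂ (Set.range (c.graphVec hk A)) = (c.param A).1 := by
  have : Set.range (c.graphVec hk A) =
      c.graphMap A '' Set.range (basis hk ⟨c.base, c.finrank_base⟩) := by
    rw [← Set.range_comp]; rfl
  rw [this, Submodule.span_image, Module.Basis.span_eq, Submodule.map_top]
  rfl

theorem Chart.linearIndependent_graphVec (hk : k = Fintype.card ι) (c : Chart k (κ → ℂ))
    (A : c.Coord) : LinearIndependent ℂ (c.graphVec hk A) :=
  (basis hk ⟨c.base, c.finrank_base⟩).linearIndependent.map' (c.graphMap A)
    (LinearMap.ker_eq_bot.2 (c.graphMap_injective A))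

/-- The coordinates of a graph vector are affine in `A`. -/
theorem Chart.analyticAt_graphVec (hk : k = Fintype.card ι) (c : Chart k (κ → ℂ)) (j : ι) (i : κ)
    (A : c.Coord) : AnalyticAt ℂ (fun A => c.graphVec hk A j i) A := by
  let v : c.base := basis hk ⟨c.base, c.finrank_base⟩ j
  let T : c.Coord →L[ℂ] ℂ := (ContinuousLinearMap.proj (R := ℂ) (φ := fun _ : κ => ℂ) i) ∘L
    c.compl.subtypeL ∘L (ContinuousLinearMap.apply ℂ c.compl v)
  have : (fun A => c.graphVec hk A j i) = fun A => (v : κ → ℂ) i + T A := rfl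
  rw [this]
  have hT : AnalyticAt ℂ T A := ContinuousLinearMap.analyticAt (𝕜 := ℂ) (E := c.Coord) (F := ℂ) T A
  exact analyticAt_const.add hT

variable [DecidableEq ι]

/-- The condition says that `p` is transverse to the span of `q`. Hence in a chart the arbitrary
basis `basisVec`, which need not vary continuously, may be replaced by `graphVec`, whose determinant
is continuous in `A`. -/
theorem isOpen_setOf_pairDet_ne_zero (σ : κ ≃ ι ⊕ ι) (hk : k = Fintype.card ι) (q : ι → κ → ℂ)
    (hq : LinearIndependent ℂ q) :
    IsOpen {p : Gr k (κ → ℂ) | pairDet σ (basisVec hk p) q ≠ 0} := by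
  refine isOpen_iSup_iff.2 fun c => isOpen_coinduced.2 ?_
  have : c.param ⁻¹' {p : Gr k (κ → ℂ) | pairDet σ (basisVec hk p) q ≠ 0} =
      {A | pairDet σ (c.graphVec hk A) q ≠ 0} := by
    ext A
    show pairDet σ _ q ≠ 0 ↔ pairDet σ _ q ≠ 0
    rw [pairDet_ne_zero_iff (linearIndependent_basisVec hk _) hq,
      pairDet_ne_zero_iff (c.linearIndependent_graphVec hk A) hq, span_basisVec, c.span_graphVec]
  rw [this]
  refine isOpen_ne_fun (continuous_iff_continuousAt.2 fun A => ?_) continuous_const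
  exact (analyticAt_pairDet (n := fun _ => q) (fun j i => c.analyticAt_graphVec hk j i A)
    fun j i => analyticAt_const).continuousAt

/-- A basis of any complement serves; the complement has dimension `k` because `k` is half the
total. -/
theorem exists_pairDet_ne_zero (σ : κ ≃ ι ⊕ ι) (hk : k = Fintype.card ι) (p : Gr k (κ → ℂ)) :
    ∃ q : ι → κ → ℂ, LinearIndependent ℂ q ∧ pairDet σ (basisVec hk p) q ≠ 0 := by
  obtain ⟨Q, hQ⟩ := p.1.exists_isCompl
  have hc : Fintype.card κ = Fintype.card ι + Fintype.card ι := by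
    rw [Fintype.card_congr σ, Fintype.card_sum]
  have hQk : Module.finrank ℂ Q = k := by
    have h1 := Submodule.finrank_add_eq_of_isCompl hQ
    have h2 := p.2
    rw [Module.finrank_fintype_fun_eq_card] at h1
    lia
  let Q' : Gr k (κ → ℂ) := ⟨Q, hQk⟩
  refine ⟨basisVec hk Q', linearIndependent_basisVec hk _, ?_⟩
  rw [pairDet_ne_zero_iff (linearIndependent_basisVec hk _) (linearIndependent_basisVec hk _),
    span_basisVec, span_basisVec]
  exact hQ.disjoint

/-- The subspaces which meet the range of an analytic family of injective operators form a
principal analytic subset. -/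
theorem isPrincipalAnalyticSubset_of_disjoint (σ : κ ≃ ι ⊕ ι) (hk : k = Fintype.card ι)
    {N : ℂ → (ι → ℂ) →ₗ[ℂ] (κ → ℂ)} (hN : ∀ lam, Function.Injective (N lam))
    (hNa : ∀ v i lam, AnalyticAt ℂ (fun lam => N lam v i) lam)
    {D : Set (Gr k (κ → ℂ) × ℂ)}
    (hD : ∀ q, q ∈ D ↔ ¬ Disjoint q.1.1 (LinearMap.range (N q.2))) :
    IsPrincipalAnalyticSubset D := by
  intro p
  obtain ⟨q, hq, hpq⟩ := exists_pairDet_ne_zero σ hk p.1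
  let n : ℂ → ι → κ → ℂ := fun lam j => N lam (Pi.basisFun ℂ ι j)
  have hn : ∀ lam, LinearIndependent ℂ (n lam) := fun lam =>
    (Pi.basisFun ℂ ι).linearIndependent.map' (N lam) (LinearMap.ker_eq_bot.2 (hN lam))
  have hns : ∀ lam, Submodule.span ℂ (Set.range (n lam)) = LinearMap.range (N lam) := fun lam => by
    have : Set.range (n lam) = N lam '' Set.range (Pi.basisFun ℂ ι) := by
      rw [← Set.range_comp]; rfl
    rw [this, Submodule.span_image, Module.Basis.span_eq, Submodule.map_top]
  -- The denominator cancels the dependence on the chosen basis and is nonzero on this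
  -- neighbourhood, which leaves `λ` unrestricted.
  refine ⟨{p | pairDet σ (basisVec hk p) q ≠ 0} ×ˢ Set.univ,
    (isOpen_setOf_pairDet_ne_zero σ hk q hq).prod isOpen_univ, ⟨hpq, trivial⟩,
    fun r => pairDet σ (basisVec hk r.1) (n r.2) / pairDet σ (basisVec hk r.1) q, ?_, ?_⟩
  · intro c z hz
    -- In the chart, `graphVec` spans the same subspace as `basisVec`, so it gives the same
    -- quotient, now with analytic numerator and denominator.
    have hf : (fun r : Gr k (κ → ℂ) × ℂ =>
          pairDet σ (basisVec hk r.1) (n r.2) / pairDet σ (basisVec hk r.1) q) ∘ c.paramProd =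
        fun z => pairDet σ (c.graphVec hk z.1) (n z.2) / pairDet σ (c.graphVec hk z.1) q := by
      ext z
      exact pairDet_div_congr ((span_basisVec hk _).trans (c.span_graphVec hk z.1).symm) _ _
    have hg : ∀ j i, AnalyticAt ℂ (fun z : c.Coord × ℂ => c.graphVec hk z.1 j i) z := fun j i =>
      (c.analyticAt_graphVec hk j i z.1).comp analyticAt_fst
    have hz' : pairDet σ (basisVec hk (c.param z.1)) q ≠ 0 := hz.1
    rw [hf]
    refine (analyticAt_pairDet hg fun j i => ?_).div
      (analyticAt_pairDet hg fun j i => analyticAt_const) ?_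
    · exact (hNa _ i z.2).comp analyticAt_snd
    · rwa [pairDet_ne_zero_iff (c.linearIndependent_graphVec hk _) hq, c.span_graphVec,
        ← span_basisVec hk, ← pairDet_ne_zero_iff (linearIndependent_basisVec hk _) hq]
  · rintro r ⟨hr, -⟩
    rw [hD, div_eq_zero_iff, or_iff_left hr, ← hns, ← span_basisVec hk r.1,
      ← pairDet_ne_zero_iff (σ := σ) (linearIndependent_basisVec hk _) (hn _), not_not]

end Basis

end Gr

theorem analyticAt_cauchyMap {E : Type*} (len : E → ℝ) (v : E × Fin 2 → ℂ) (i : E × Fin 4)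
    (lam : ℂ) : AnalyticAt ℂ (fun lam => cauchyMap len lam v i) lam := by
  obtain ⟨e, i⟩ := i
  have hC := analyticAt_cosSol (len e) lam
  have hS := analyticAt_sinSol (len e) lam
  fin_cases i
  · exact (analyticAt_const.mul analyticAt_const).add (analyticAt_const.mul analyticAt_const)
  · exact (analyticAt_const.mul analyticAt_const).add (analyticAt_const.mul analyticAt_const)
  · exact (analyticAt_const.mul hC).add (analyticAt_const.mul hS)
  · exact (analyticAt_const.mul (analyticAt_id.mul hS)).add (analyticAt_const.mul hC.neg)

end

theorem theorem1 {E : Type*} [Fintype E] (len : E → ℝ) (hlen : ∀ e, 0 < len e) :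
    Gr.IsPrincipalAnalyticSubset (dispersionRelation len) := by
  classical
  have σ : E × Fin 4 ≃ (E × Fin 2) ⊕ (E × Fin 2) := Fintype.equivOfCardEq (by simp; lia)
  refine Gr.isPrincipalAnalyticSubset_of_disjoint σ (by simp [mul_comm])
    (fun lam => cauchyMap_injective (len := len) lam) (analyticAt_cauchyMap len) fun q => ?_
  exact not_congr (shiftedOp_isInvertible_iff hlen q.1.2 q.2)
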